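/- Let $n\ge 1$, equip $\mathbb{R}^n$ with the square metric $d_\infty(x,y)=\max_j|x_j-y_j|$, and let $B[0,1]$ be its closed unit ball. Let $A=\operatorname{diag}(\beta_{11},\dots,\beta_{nn})$ with all $\beta_{jj}\in(0,1/5)$, put $\beta_{\max}=\max_j\beta_{jj}$, and write $A^{s}=\operatorname{diag}(\beta_{11}^{s},\dots,\beta_{nn}^{s})$ for real $s$. **Affine thickness.** For a compact set $C\subseteq B[0,1]$, let $(G_k)_{k\in J}$, $J\subseteq\mathbb{N}$, be the bounded connected components of $\mathbb{R}^n\setminus C$, and let $E$ be the union of the unbounded connected components of $\mathbb{R}^n\setminus C$. For $F\subseteq B[0,1]$ put $$S_A(F)=\inf\{t>0:\exists z\in\mathbb{R}^n,\ F\subseteq A^{1/t}(B[0,1])+z\}.$$ Assume that $(G_k)_{k\in J}$ is listed without repetition in non-increasing order of $S_A$, and for $m\in J$ put $$GD_A(m,C)=\inf\Big\{t>0:\exists z\in\mathbb{R}^n,\ G_m\cap(A^{1/t}(B[0,1])+z)\ne\emptyset,\ (A^{1/t}(B[0,1])+z)\cap\Big(\bigcup_{i\in J,\,i<m}G_i\cup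 E\Big)\neq\emptyset\Big\}.$$ Here $\inf\emptyset=\infty$ and $1/\infty=0$. The thickness of $C$ with respect to $A$ is $$\tau_A(C)=\inf_{k\in J}\big\{S_A(G_k)^{-1}-GD_A(k,C)^{-1}\big\},$$ with $\tau_A(C)=-\infty$ if $GD_A(k,C)=0$ for some $k\in J$; if $J=\emptyset$, then $\tau_A(C)=\infty$ when $\operatorname{int}(C)\ne\emptyset$ and $\tau_A(C)=-\infty$ when $\operatorname{int}(C)=\emptyset$. **Theorem.** Let $I$ be an at most countable set, and for each $i\in I$ let $C_i\subseteq B[0,1]$ be a compact set with bounded gaps $(G^{(i)}_k)_{k\in J_i}$, ordered as above, and unbounded gap $E^{(i)}$, such that $\tau_A(C_i)\notin\{-\infty,\infty\}$. Set $$C=\bigcap_{i\in I}(C_i\cup E^{(i)}),\qquad \alpha_{\tau_A(C_i)}=\prod_{j=1}^n\beta_{jj}^{\tau_A(C_i)-1}.$$ Suppose that $\alpha,c,\delta\in(0,1)$ satisfy $\alpha^c=\sum_{i\in I}\alpha_{\tau_A(C_i)}^c$, $$\alpha^c\le\delta^2\Big(1-\Big(\prod_{j=1}^n\beta_{jj}\Big)^{1-c}\Big)<1$$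 and $$\kappa:=\prod_{j=1}^n\Big(\tfrac13\big(1-5\beta_{jj}^{\lfloor\delta\alpha^{-1}\rfloor}\big)\Big)-8^n(1+2^{2n+1})\delta>0 .$$ Put $K_1=2\delta^{-1}|\log\kappa|$. Then for every $y\in\mathbb{R}^n$ we have $C\cap(A(B[0,1])+y)\ne\emptyset$, and $$\dim_H\big(C\cap(A(B[0,1])+y)\big)\ \ge\ \max\Big\{n-K_1\frac{\alpha}{|\log\beta_{\max}|},\,0\Big\}.$$ -/

import Mathlib

noncomputable section

namespace AffineThickness

open Matrix Metric

variable {n : ℕ}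

/-- The set `A ^ s (B[0,1]) + z`, where `A = diag (β 1, …, β n)`, so that
`A ^ s = diag (β 1 ^ s, …, β n ^ s)`. On `Fin n → ℝ` the norm is the maximum norm, so that
`closedBall 0 1` is the closed unit ball `B[0,1]` of the square metric. -/
def box (β : Fin n → ℝ) (s : ℝ) (z : Fin n → ℝ) : Set (Fin n → ℝ) :=
  (fun x => Matrix.diagonal (fun j => β j ^ s) *ᵥ x + z) '' closedBall 0 1

/-- The bounded gaps of `C`: the bounded connected components of the complement of `C`. -/
def boundedGaps (C : Set (Fin n → ℝ)) : Set (Set (Fin n → ℝ)) :=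
  {G | (∃ x ∈ Cᶜ, G = connectedComponentIn Cᶜ x) ∧ Bornology.IsBounded G}

/-- The unbounded gap `E` of `C`: the union of the unbounded connected components of the
complement of `C`. For compact `C` there is exactly one such component if `n ≥ 2`. -/
def unboundedGap (C : Set (Fin n → ℝ)) : Set (Fin n → ℝ) :=
  {x | x ∈ Cᶜ ∧ ¬ Bornology.IsBounded (connectedComponentIn Cᶜ x)}

/-- The size `S_A(F)` of `F` with respect to `A = diag β`; it is `∞` if there is no `t`. -/
def size (β : Fin n → ℝ) (F : Set (Fin n → ℝ)) : ENNReal :=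
  sInf (ENNReal.ofReal '' {t : ℝ | 0 < t ∧ ∃ z, F ⊆ box β (1 / t) z})

/-- `(G k)_{k ∈ J}` lists every bounded gap of `C` exactly once, in non-increasing size. -/
def IsOrderedGaps (β : Fin n → ℝ) (C : Set (Fin n → ℝ)) (J : Set ℕ)
    (G : ℕ → Set (Fin n → ℝ)) : Prop :=
  Set.BijOn G J (boundedGaps C) ∧ AntitoneOn (fun k => size β (G k)) J

/-- The gap distance `GD_A(m, C)` with respect to `A = diag β`. -/
def gapDistance (β : Fin n → ℝ) (C : Set (Fin n → ℝ)) (J : Set ℕ)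
    (G : ℕ → Set (Fin n → ℝ)) (m : ℕ) : ENNReal :=
  sInf (ENNReal.ofReal '' {t : ℝ | 0 < t ∧ ∃ z, (G m ∩ box β (1 / t) z).Nonempty ∧
    (box β (1 / t) z ∩ ((⋃ i ∈ {i | i ∈ J ∧ i < m}, G i) ∪ unboundedGap C)).Nonempty})

open Classical in
/-- The thickness `τ_A(C)` with respect to `A = diag β`, computed from the ordered gaps
`(G k)_{k ∈ J}` of `C`. Inverses are taken in `[0, ∞]`, differences in `[-∞, ∞]`. -/
def thickness (β : Fin n → ℝ) (C : Set (Fin n → ℝ)) (J : Set ℕ)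
    (G : ℕ → Set (Fin n → ℝ)) : EReal :=
  if J = ∅ then (if (interior C).Nonempty then ⊤ else ⊥)
  else if ∃ k ∈ J, gapDistance β C J G k = 0 then ⊥
  else ⨅ k ∈ J, (((size β (G k))⁻¹ : ENNReal) : EReal) -
    (((gapDistance β C J G k)⁻¹ : ENNReal) : EReal)

/-- `α_τ = ∏ j, β j ^ (τ - 1)`. -/
def alphaOf (β : Fin n → ℝ) (τ : ℝ) : ℝ := ∏ j, β j ^ (τ - 1)

/-- The quantity
`∏ j, (1/3) (1 - 5 β j ^ ⌊δ α⁻¹⌋) - 8 ^ n (1 + 2 ^ (2 n + 1)) δ`. -/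
def kappa (β : Fin n → ℝ) (δ α : ℝ) : ℝ :=
  (∏ j, (1 / 3 : ℝ) * (1 - 5 * β j ^ ⌊δ * α⁻¹⌋)) - 8 ^ n * (1 + 2 ^ (2 * n + 1)) * δ

/-- The constant `K₁ = 2 δ⁻¹ |log kappa|`. -/
def K₁ (β : Fin n → ℝ) (δ α : ℝ) : ℝ := 2 * δ⁻¹ * |Real.log (kappa β δ α)|

end AffineThickness

end

/-! ### Boxes, tilings and the decomposition of gaps into pieces -/

namespace AffineThickness

open Filter Topology

/-! Thickness turns the order of the gaps into a scale. Tile space by boxes of each exponent m ≥ 1.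
For a point of a bounded gap, take the least m at which no gap of smaller index meets the tile of
the point. One scale coarser an earlier gap did meet the tile, so the gap of the point has exponent
at least q = τ + m - 1. Hence the set to be avoided is covered by one small piece per set, scale and
tile (`exists_gap_pieces`).

The pieces are avoided by a potential argument. Let V = ∏ β j. A box with exponent p pays V ^ (c (q
- p)) for every piece of scale m < p that meets it, and it is good if the total is at most δ < 1;
then all these pieces have q > p (`lt_exponent_of_potential_le`). Double counting shows that among
the roughly V ^ (-N) subboxes with exponent p + N of a good box, only a small multiple of δ V ^ (-N)
are not good (`card_large_potential_le`): pieces of scale below p are paid for by the potential of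
the parent, those of scale in [p, p + N) by the sums of α_i and of α_i ^ c, where α_i = V ^ (τ_i -
1). The choice N = ⌊δ / α⌋ keeps N α ≤ δ and still makes V ^ (N (1 - c)) ≤ δ. So a good box has at
least κ V ^ (-N) good children.

The box A(B[0,1]) + y has potential zero and is the root of a tree of good boxes. A limit point of a
branch lies in no piece, since the price of that piece alone would eventually exceed δ. The uniform
measure on the branches and the mass distribution principle bound the dimension by n - log κ / log
(β_max ^ N) (`nonempty_and_le_dimH_of_tree`), and N ≥ δ / (2 α) gives the stated constant. -/

theorem mem_box_iff {n : ℕ} {β : Fin n → ℝ} (hβ : ∀ j, 0 < β j) (s : ℝ) (z x : Fin n → ℝ) :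
    x ∈ box β s z ↔ ∀ j, |x j - z j| ≤ β j ^ s := by
  have hpos : ∀ j, 0 < β j ^ s := fun j => Real.rpow_pos_of_pos (hβ j) s
  simp only [box, Set.mem_image, mem_closedBall_zero_iff]
  constructor
  · rintro ⟨w, hw, rfl⟩ j
    have h1 : |w j| ≤ 1 := by
      simpa using (pi_norm_le_iff_of_nonneg zero_le_one).1 hw j
    simp only [Pi.add_apply, Matrix.mulVec_diagonal, add_sub_cancel_right, abs_mul,
      abs_of_pos (hpos j)]
    exact mul_le_of_le_one_right (hpos j).le h1
  · intro h
    refine ⟨fun j => (x j - z j) / β j ^ s, ?_, ?_⟩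
    · refine (pi_norm_le_iff_of_nonneg zero_le_one).2 fun j => ?_
      rw [Real.norm_eq_abs, abs_div, abs_of_pos (hpos j)]
      exact (div_le_one (hpos j)).2 (h j)
    · ext j
      simp only [Pi.add_apply, Matrix.mulVec_diagonal]
      rw [mul_div_cancel₀ _ (hpos j).ne']
      ring

/-- A set of size at most `1 / e` has width at most `2 β j ^ e` in the direction `j`. -/
theorem abs_sub_le_of_le_size_inv {n : ℕ} {β : Fin n → ℝ} (hβ : ∀ j, 0 < β j)
    (hβ1 : ∀ j, β j < 1) {F : Set (Fin n → ℝ)} {e : ℝ} (he : 0 < e)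
    (h : ENNReal.ofReal e ≤ (size β F)⁻¹) {x y : Fin n → ℝ} (hx : x ∈ F) (hy : y ∈ F) (j : Fin n) :
    |x j - y j| ≤ 2 * β j ^ e := by
  -- The infimum in `size` need not be attained, so the bound is proved for each smaller exponent
  -- and passed to the limit.
  have key : ∀ e' ∈ Set.Ioo 0 e, |x j - y j| ≤ 2 * β j ^ e' := by
    rintro e' ⟨h0, h1⟩
    have h2 : size β F < ENNReal.ofReal e'⁻¹ := by
      have h3 : ENNReal.ofReal e' < (size β F)⁻¹ :=
        lt_of_lt_of_le ((ENNReal.ofReal_lt_ofReal_iff he).2 h1) h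
      rw [ENNReal.ofReal_inv_of_pos h0]
      exact ENNReal.lt_inv_iff_lt_inv.1 h3
    obtain ⟨_, ⟨t, ⟨ht, z, hz⟩, rfl⟩, h4⟩ := sInf_lt_iff.1 h2
    have h5 : t < e'⁻¹ := (ENNReal.ofReal_lt_ofReal_iff (inv_pos.2 h0)).1 h4
    have h6 : e' ≤ 1 / t := by
      rw [one_div]
      exact ((lt_inv_comm₀ ht h0).1 h5).le
    have h7 : β j ^ (1 / t) ≤ β j ^ e' :=
      Real.rpow_le_rpow_of_exponent_ge (hβ j) (hβ1 j).le h6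
    have hx' := (mem_box_iff hβ _ _ _).1 (hz hx) j
    have hy' := (mem_box_iff hβ _ _ _).1 (hz hy) j
    rw [abs_le] at hx' hy' ⊢
    constructor <;> linarith [hx'.1, hx'.2, hy'.1, hy'.2]
  have hc : Tendsto (fun e' => 2 * β j ^ e') (𝓝[<] e) (𝓝 (2 * β j ^ e)) := by
    have : Continuous fun e' : ℝ => 2 * β j ^ e' :=
      continuous_const.mul (Real.continuous_const_rpow (hβ j).ne')
    exact this.continuousAt.tendsto.mono_left nhdsWithin_le_nhds
  refine ge_of_tendsto hc ?_
  filter_upwards [Ioo_mem_nhdsLT he] with e' he' using key e' he'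

/-- The closed box with lower corner `a` and side lengths `2 β j ^ p`. -/
def cornerBox {n : ℕ} (β : Fin n → ℝ) (p : ℕ) (a : Fin n → ℝ) : Set (Fin n → ℝ) :=
  Set.Icc a (fun j => a j + 2 * β j ^ p)

/-- The lower corners of a tiling of space by boxes with side lengths `2 β j ^ m`. -/
def tileCorner {n : ℕ} (β : Fin n → ℝ) (m : ℕ) (k : Fin n → ℤ) : Fin n → ℝ :=
  fun j => 2 * β j ^ m * k j

theorem cornerBox_eq_box {n : ℕ} {β : Fin n → ℝ} (hβ : ∀ j, 0 < β j) (p : ℕ) (a : Fin n → ℝ) :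
    cornerBox β p a = box β p (fun j => a j + β j ^ p) := by
  ext x
  rw [mem_box_iff hβ]
  simp only [cornerBox, Set.mem_Icc, Pi.le_def, ← forall_and, Real.rpow_natCast, abs_le]
  refine forall_congr' fun j => ?_
  constructor <;> rintro ⟨h1, h2⟩ <;> constructor <;> linarith

theorem mem_cornerBox_floor {n : ℕ} {β : Fin n → ℝ} (hβ : ∀ j, 0 < β j) (m : ℕ) (x : Fin n → ℝ) :
    x ∈ cornerBox β m (tileCorner β m fun j => ⌊x j / (2 * β j ^ m)⌋) := by
  have h : ∀ j, 0 < 2 * β j ^ m := fun j => by have := hβ j; positivity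
  constructor
  · intro j
    have := Int.floor_le (x j / (2 * β j ^ m))
    rw [le_div_iff₀ (h j)] at this
    simp only [tileCorner]
    linarith
  · intro j
    have := (Int.lt_floor_add_one (x j / (2 * β j ^ m))).le
    rw [div_le_iff₀ (h j)] at this
    simp only [tileCorner]
    linarith

/-- If a box with exponent `p` meets a gap and something that precedes it, then the gap has
exponent at least `τ + p`. -/
theorem le_size_inv_of_box_meets {n : ℕ} {β : Fin n → ℝ} {C : Set (Fin n → ℝ)}
    {J : Set ℕ} {G : ℕ → Set (Fin n → ℝ)}
    (hτ_top : thickness β C J G ≠ ⊤) (hτ_bot : thickness β C J G ≠ ⊥)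
    {k : ℕ} (hk : k ∈ J) {p : ℝ} (hp : 0 ≤ p)
    (h : 0 < p → ∃ z, (G k ∩ box β p z).Nonempty ∧
      (box β p z ∩ ((⋃ i ∈ {i | i ∈ J ∧ i < k}, G i) ∪ unboundedGap C)).Nonempty) :
    ENNReal.ofReal ((thickness β C J G).toReal + p) ≤ (size β (G k))⁻¹ := by
  -- For p = 0 no box is needed, as the inverse gap distance is at least 0. This is the case of
  -- scale m = 1 below.
  have hd : ENNReal.ofReal p ≤ (gapDistance β C J G k)⁻¹ := by
    rcases hp.eq_or_lt with rfl | hp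
    · simp
    · rw [← inv_inv (ENNReal.ofReal p), ← ENNReal.ofReal_inv_of_pos hp, ENNReal.inv_le_inv]
      refine sInf_le ⟨p⁻¹, ⟨inv_pos.2 hp, ?_⟩, rfl⟩
      simpa using h hp
  have hJ : J ≠ ∅ := Set.nonempty_iff_ne_empty.1 ⟨k, hk⟩
  have hGD : ¬ ∃ k ∈ J, gapDistance β C J G k = 0 := by
    intro h0
    exact hτ_bot (by rw [thickness, if_neg hJ, if_pos h0])
  have hle : thickness β C J G ≤ (((size β (G k))⁻¹ : ENNReal) : EReal) -
      (((gapDistance β C J G k)⁻¹ : ENNReal) : EReal) := by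
    rw [thickness, if_neg hJ, if_neg hGD]
    exact iInf₂_le k hk
  have h1 := EReal.add_le_of_le_sub hle
  have h2 : (((thickness β C J G).toReal + p : ℝ) : EReal) ≤
      (((size β (G k))⁻¹ : ENNReal) : EReal) := by
    refine le_trans ?_ h1
    rw [EReal.coe_add, EReal.coe_toReal hτ_top hτ_bot]
    gcongr
    calc (p : EReal) ≤ ((ENNReal.ofReal p : ENNReal) : EReal) := by
          rw [EReal.coe_ennreal_ofReal, max_eq_left hp]
      _ ≤ _ := by exact_mod_cast hd
  rw [← EReal.coe_ennreal_le_coe_ennreal_iff, EReal.coe_ennreal_ofReal]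
  rcases max_cases ((thickness β C J G).toReal + p) 0 with ⟨h, -⟩ | ⟨h, -⟩ <;> rw [h]
  · exact h2
  · exact EReal.coe_ennreal_nonneg _

theorem eventually_cornerBox_subset {n : ℕ} {β : Fin n → ℝ} (hβ : ∀ j, 0 < β j)
    (hβ1 : ∀ j, β j < 1) {x : Fin n → ℝ} {U : Set (Fin n → ℝ)} (hU : U ∈ 𝓝 x) :
    ∀ᶠ m : ℕ in atTop, ∀ a, x ∈ cornerBox β m a → cornerBox β m a ⊆ U := by
  obtain ⟨ε, hε, hεU⟩ := Metric.mem_nhds_iff.1 hU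
  have h1 : ∀ j, ∀ᶠ m : ℕ in atTop, 2 * β j ^ m < ε := fun j => by
    have := (tendsto_pow_atTop_nhds_zero_of_lt_one (hβ j).le (hβ1 j)).const_mul 2
    rw [mul_zero] at this
    exact this.eventually_lt_const hε
  filter_upwards [eventually_all.2 h1] with m hm a hx y hy
  refine hεU ((dist_pi_lt_iff hε).2 fun j => ?_)
  rw [Real.dist_eq, abs_lt]
  have := hx.1 j; have := hx.2 j; have := hy.1 j; have := hy.2 j; have := hm j
  constructor <;> linarith

/-- The complement of `C ∪ E` is covered by small pieces of gaps, one for each tile of each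
tiling by boxes of exponents `m = 1, 2, …`; the piece in a tile of exponent `m` has exponent
`τ + m - 1`. -/
theorem exists_gap_pieces {n : ℕ} {β : Fin n → ℝ} (hβ : ∀ j, 0 < β j) (hβ1 : ∀ j, β j < 1)
    {C : Set (Fin n → ℝ)} (hC : IsCompact C) {J : Set ℕ} {G : ℕ → Set (Fin n → ℝ)}
    (hG : IsOrderedGaps β C J G) (hτ_top : thickness β C J G ≠ ⊤)
    (hτ_bot : thickness β C J G ≠ ⊥) (hτ : 0 < (thickness β C J G).toReal) :
    ∃ D : ℕ → (Fin n → ℤ) → Set (Fin n → ℝ),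
      (∀ m k, D m k ⊆ cornerBox β m (tileCorner β m k)) ∧
      (∀ m, 1 ≤ m → ∀ k, ∀ x ∈ D m k, ∀ y ∈ D m k, ∀ j,
        |x j - y j| ≤ 2 * β j ^ ((thickness β C J G).toReal + m - 1)) ∧
      (∀ x, x ∉ C ∪ unboundedGap C → ∃ m, 1 ≤ m ∧ ∃ k, x ∈ D m k) := by
  set τ := (thickness β C J G).toReal with hτdef
  let T : ℕ → (Fin n → ℤ) → Set (Fin n → ℝ) := fun m k => cornerBox β m (tileCorner β m k)
  let first : ℕ → (Fin n → ℤ) → ℕ → Prop := fun m k l => ∀ i ∈ J, i < l → ¬ (G i ∩ T m k).Nonempty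
  refine ⟨fun m k => {x | x ∈ T m k ∧ ∃ l ∈ J, x ∈ G l ∧ first m k l ∧
    ENNReal.ofReal (τ + (m - 1)) ≤ (size β (G l))⁻¹}, fun m k x hx => hx.1, ?_, ?_⟩
  · rintro m hm k x ⟨hxT, l, hl, hxl, hlf, hls⟩ y ⟨hyT, l', hl', hyl, hlf', hls'⟩ j
    -- Two gaps that both meet the tile cannot both be first, so each tile carries a part of a
    -- single gap.
    have : l = l' := by
      rcases lt_trichotomy l l' with h | h | h
      · exact absurd ⟨x, hxl, hxT⟩ (hlf' l hl h)
      · exact h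
      · exact absurd ⟨y, hyl, hyT⟩ (hlf l' hl' h)
    subst this
    have hm' : (1 : ℝ) ≤ m := by exact_mod_cast hm
    rw [add_sub_assoc]
    exact abs_sub_le_of_le_size_inv hβ hβ1 (by linarith) hls hxl hyl j
  · intro x hx
    rw [Set.mem_union, not_or] at hx
    have hxb : Bornology.IsBounded (connectedComponentIn Cᶜ x) := by
      by_contra h
      exact hx.2 ⟨hx.1, h⟩
    obtain ⟨l, hl, hGl⟩ := hG.1.surjOn ⟨⟨x, hx.1, rfl⟩, hxb⟩
    have hxl : x ∈ G l := by
      rw [hGl]; exact mem_connectedComponentIn hx.1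
    have hopen : IsOpen (G l) := by
      rw [hGl]; exact hC.isClosed.isOpen_compl.connectedComponentIn
    have hdisj : ∀ i ∈ J, i ≠ l → ∀ y ∈ G l, y ∉ G i := by
      intro i hi hil y hyl hyi
      obtain ⟨⟨x', -, hx'⟩, -⟩ := hG.1.mapsTo hi
      refine hil (hG.1.injOn hi hl ?_)
      rw [hx'] at hyi ⊢
      rw [hGl] at hyl ⊢
      rw [connectedComponentIn_eq hyi, connectedComponentIn_eq hyl]
    let κ : ℕ → Fin n → ℤ := fun m j => ⌊x j / (2 * β j ^ m)⌋
    have hxT : ∀ m, x ∈ T m (κ m) := fun m => mem_cornerBox_floor hβ m x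
    -- A small enough tile around x lies in the open set `G l`, which is disjoint from the other
    -- gaps. The least such m is used: minimality supplies the earlier gap in the tile with exponent
    -- m - 1.
    have hex : ∃ m, 1 ≤ m ∧ first m (κ m) l := by
      obtain ⟨m, hm, hm1⟩ := ((eventually_cornerBox_subset hβ hβ1
        (hopen.mem_nhds hxl)).and (eventually_ge_atTop 1)).exists
      refine ⟨m, hm1, fun i hi hil => ?_⟩
      rintro ⟨y, hyi, hyT⟩
      exact hdisj i hi hil.ne y (hm _ (hxT m) hyT) hyi
    classical
    obtain ⟨hm1, hmf⟩ := Nat.find_spec hex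
    have hmin := fun m' => Nat.find_min (m := m') hex
    set m := Nat.find hex
    refine ⟨m, hm1, κ m, hxT m, l, hl, hxl, hmf, ?_⟩
    have hm' : (1 : ℝ) ≤ m := by exact_mod_cast hm1
    refine le_size_inv_of_box_meets hτ_top hτ_bot hl (by linarith) fun hpos => ?_
    have hm2 : 1 ≤ m - 1 := by
      have : (1 : ℝ) < m := by linarith
      have : 1 < m := by exact_mod_cast this
      omega
    have hcast : ((m : ℝ) - 1) = ((m - 1 : ℕ) : ℝ) := by push_cast [hm1]; ring
    have h1 := hmin (m - 1) (by omega)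
    simp only [hm2, true_and, first] at h1
    push Not at h1
    obtain ⟨i, hi, hil, y, hyi, hyT⟩ := h1
    refine ⟨fun j => tileCorner β (m - 1) (κ (m - 1)) j + β j ^ (m - 1), ?_, ?_⟩
    · rw [hcast, ← cornerBox_eq_box hβ]
      exact ⟨x, hxl, hxT _⟩
    · rw [hcast, ← cornerBox_eq_box hβ]
      exact ⟨y, hyT, Or.inl (Set.mem_biUnion (show i ∈ {i | i ∈ J ∧ i < l} from ⟨hi, hil⟩) hyi)⟩

end AffineThickness

/-! ### Counting boxes by volume -/

namespace AffineThickness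

open MeasureTheory

/-- Disjoint translates of a box that lie in a larger box are counted by comparing volumes. -/
theorem card_mul_prod_le_of_disjoint {n : ℕ} {ι : Type*} (s : Finset ι) (a : ι → Fin n → ℝ)
    {l A L : Fin n → ℝ} (hl : ∀ j, 0 ≤ l j) (hL : ∀ j, 0 ≤ L j)
    (hdisj : (s : Set ι).PairwiseDisjoint fun i =>
      Set.univ.pi fun j => Set.Ico (a i j) (a i j + l j))
    (hsub : ∀ i ∈ s, ∀ j, A j ≤ a i j ∧ a i j + l j ≤ A j + L j) :
    (s.card : ℝ) * ∏ j, l j ≤ ∏ j, L j := by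
  have hvol : ∀ (b w : Fin n → ℝ), (∀ j, 0 ≤ w j) →
      volume (Set.univ.pi fun j => Set.Ico (b j) (b j + w j)) = ENNReal.ofReal (∏ j, w j) := by
    intro b w hw
    rw [Real.volume_pi_Ico, ENNReal.ofReal_prod_of_nonneg fun j _ => hw j]
    simp
  have h1 : ∑ i ∈ s, volume (Set.univ.pi fun j => Set.Ico (a i j) (a i j + l j)) ≤
      volume (Set.univ.pi fun j => Set.Ico (A j) (A j + L j)) := by
    rw [← measure_biUnion_finset hdisj fun i _ => MeasurableSet.univ_pi fun j => measurableSet_Ico]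
    refine measure_mono (Set.iUnion₂_subset fun i hi => Set.pi_mono fun j _ => ?_)
    exact Set.Ico_subset_Ico (hsub i hi j).1 (hsub i hi j).2
  simp only [hvol _ _ hl, hvol _ _ hL, Finset.sum_const, nsmul_eq_mul] at h1
  rw [← ENNReal.ofReal_natCast, ← ENNReal.ofReal_mul (by positivity)] at h1
  exact (ENNReal.ofReal_le_ofReal_iff (Finset.prod_nonneg fun j _ => hL j)).1 h1

/-- The number of disjoint translates of a box whose closures meet a given set of bounded width. -/
theorem card_mul_prod_le_of_meets {n : ℕ} {ι : Type*} (s : Finset ι) (a : ι → Fin n → ℝ)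
    {l d : Fin n → ℝ} (hl : ∀ j, 0 ≤ l j) (hd : ∀ j, 0 ≤ d j)
    (hdisj : (s : Set ι).PairwiseDisjoint fun i =>
      Set.univ.pi fun j => Set.Ico (a i j) (a i j + l j))
    {F : Set (Fin n → ℝ)} (hF : ∀ x ∈ F, ∀ y ∈ F, ∀ j, |x j - y j| ≤ d j)
    (hmeet : ∀ i ∈ s, (Set.Icc (a i) (fun j => a i j + l j) ∩ F).Nonempty) :
    (s.card : ℝ) * ∏ j, l j ≤ ∏ j, (2 * d j + 2 * l j) := by
  have hL : ∀ j, 0 ≤ 2 * d j + 2 * l j := fun j => by linarith [hl j, hd j]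
  rcases s.eq_empty_or_nonempty with rfl | ⟨i₀, hi₀⟩
  · simpa using Finset.prod_nonneg fun j _ => hL j
  obtain ⟨x₀, -, hx₀⟩ := hmeet i₀ hi₀
  -- A box that meets F stays within d + l of a fixed point x₀ of F, which gives a window of width 2
  -- d + 2 l.
  refine card_mul_prod_le_of_disjoint s a (A := fun j => x₀ j - d j - l j) hl hL hdisj ?_
  intro i hi j
  obtain ⟨x, hx, hxF⟩ := hmeet i hi
  have h1 := hx.1 j
  have h2 := hx.2 j
  have h3 := abs_le.1 (hF x hxF x₀ hx₀ j)
  simp only at h2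
  constructor <;> linarith [h3.1, h3.2]

theorem pairwiseDisjoint_lattice {n : ℕ} {l b : Fin n → ℝ} (hl : ∀ j, 0 < l j)
    (s : Set (Fin n → ℤ)) :
    s.PairwiseDisjoint fun k => Set.univ.pi fun j => Set.Ico (b j + l j * k j)
      (b j + l j * k j + l j) := by
  intro k _ k' _ hne
  obtain ⟨j, hj⟩ := Function.ne_iff.1 hne
  refine Set.disjoint_left.2 fun x hx hx' => ?_
  have h1 := hx j trivial
  have h2 := hx' j trivial
  rcases lt_or_gt_of_ne hj with h | h
  · have h3 : (k j : ℝ) + 1 ≤ k' j := by exact_mod_cast h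
    nlinarith [h1.2, h2.1, hl j]
  · have h3 : (k' j : ℝ) + 1 ≤ k j := by exact_mod_cast h
    nlinarith [h1.1, h2.2, hl j]

/-- The number of lattice boxes with exponent `m` that meet a given set of exponent `e`. -/
theorem card_lattice_le {n : ℕ} {β : Fin n → ℝ} (hβ : ∀ j, 0 < β j) (hβ1 : ∀ j, β j < 1)
    (m : ℕ) (b : Fin n → ℝ) (s : Finset (Fin n → ℤ)) {F : Set (Fin n → ℝ)} {e : ℝ}
    (hF : ∀ x ∈ F, ∀ y ∈ F, ∀ j, |x j - y j| ≤ 2 * β j ^ e)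
    (hmeet : ∀ k ∈ s, (cornerBox β m (fun j => b j + 2 * β j ^ m * k j) ∩ F).Nonempty) :
    (s.card : ℝ) ≤ 4 ^ n * max 1 ((∏ j, β j) ^ (e - m)) := by
  have hl : ∀ j, 0 < 2 * β j ^ m := fun j => by have := hβ j; positivity
  have h := card_mul_prod_le_of_meets s (fun k j => b j + 2 * β j ^ m * k j)
    (fun j => (hl j).le) (d := fun j => 2 * β j ^ e)
    (fun j => by have := Real.rpow_pos_of_pos (hβ j) e; positivity)
    (pairwiseDisjoint_lattice hl _) hF hmeet
  have hP : 0 < ∏ j, 2 * β j ^ m := Finset.prod_pos fun j _ => hl j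
  refine le_of_mul_le_mul_right (h.trans ?_) hP
  have hpow : ∀ j, β j ^ e = β j ^ (e - m) * β j ^ m := fun j => by
    rw [← Real.rpow_natCast, ← Real.rpow_add (hβ j)]; ring_nf
  -- The sign of e - m decides for all coordinates at once which of the two side lengths is larger.
  -- The factor c is 1 or β j ^ (e - m) accordingly.
  have hterm : ∀ c : Fin n → ℝ, (∀ j, 0 ≤ c j) →
      (∀ j, 2 * (2 * β j ^ e) + 2 * (2 * β j ^ m) ≤ 4 * c j * (2 * β j ^ m)) →
      ∏ j, (2 * (2 * β j ^ e) + 2 * (2 * β j ^ m)) ≤ 4 ^ n * (∏ j, c j) * ∏ j, 2 * β j ^ m := by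
    intro c hc hle
    calc _ ≤ ∏ j, 4 * c j * (2 * β j ^ m) := by
          refine Finset.prod_le_prod (fun j _ => ?_) fun j _ => hle j
          have := Real.rpow_pos_of_pos (hβ j) e
          have := hl j
          linarith
      _ = _ := by rw [Finset.prod_mul_distrib, Finset.prod_mul_distrib]; simp
  rcases le_total 0 (e - m) with he | he
  · refine (hterm 1 (fun _ => zero_le_one) fun j => ?_).trans ?_
    · have h1 : β j ^ (e - m) ≤ 1 := Real.rpow_le_one (hβ j).le (hβ1 j).le he
      rw [hpow j, Pi.one_apply]
      nlinarith [hl j]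
    · simp only [Pi.one_apply, Finset.prod_const_one]
      gcongr
      exact le_max_left _ _
  · refine (hterm (fun j => β j ^ (e - m)) (fun j => Real.rpow_nonneg (hβ j).le _)
      fun j => ?_).trans ?_
    · have h1 : 1 ≤ β j ^ (e - m) := Real.one_le_rpow_of_pos_of_le_one_of_nonpos (hβ j) (hβ1 j).le he
      rw [hpow j]
      nlinarith [hl j]
    · rw [Real.finsetProd_rpow _ _ fun j _ => (hβ j).le]
      gcongr
      exact le_max_right _ _

end AffineThickness

/-! ### The potential and the count of boxes with large potential -/

noncomputable section

namespace AffineThickness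

/-- The total weight, relative to a box with exponent `p` and lower corner `a`, of the pieces
`D i m k` with `1 ≤ m < p` that meet this box. -/
def potential {n : ℕ} {I : Type*} (β : Fin n → ℝ) (τ : I → ℝ)
    (D : I → ℕ → (Fin n → ℤ) → Set (Fin n → ℝ)) (c : ℝ) (p : ℕ) (a : Fin n → ℝ) : ENNReal :=
  open Classical in
  ∑' e : I × ℕ × (Fin n → ℤ),
    if (1 ≤ e.2.1 ∧ e.2.1 < p) ∧ (cornerBox β p a ∩ D e.1 e.2.1 e.2.2).Nonempty then
      ENNReal.ofReal ((∏ j, β j) ^ (c * (τ e.1 + e.2.1 - 1 - p))) else 0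

section

variable {n : ℕ} {I : Type*} {β : Fin n → ℝ} {τ : I → ℝ}
  {D : I → ℕ → (Fin n → ℤ) → Set (Fin n → ℝ)} {c δ : ℝ}

theorem prod_lt_one_of_forall_lt (hn : 0 < n) (hβ : ∀ j, 0 < β j) (hβ1 : ∀ j, β j < 1) :
    ∏ j, β j < 1 := by
  have : Nonempty (Fin n) := ⟨⟨0, hn⟩⟩
  simpa using Finset.prod_lt_prod_of_nonempty (g := fun _ => (1 : ℝ)) (fun j _ => hβ j)
    (fun j _ => hβ1 j) Finset.univ_nonempty

theorem potential_one (a : Fin n → ℝ) : potential β τ D c 1 a = 0 := by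
  rw [potential, ENNReal.tsum_eq_zero]
  intro e
  rw [if_neg]
  omega

/-- A piece whose exponent is at most p would contribute at least 1 > δ by itself. This keeps large
pieces out of good boxes, and in the limit keeps the points of the tree out of all pieces. -/
theorem lt_exponent_of_potential_le (hV : 0 < ∏ j, β j) (hV1 : ∏ j, β j < 1) (hc : 0 < c)
    (hδ1 : δ < 1) {p : ℕ} {a : Fin n → ℝ} (hpot : potential β τ D c p a ≤ ENNReal.ofReal δ)
    {i : I} {m : ℕ} {k : Fin n → ℤ} (hm : 1 ≤ m) (hmp : m < p)
    (hne : (cornerBox β p a ∩ D i m k).Nonempty) : (p : ℝ) < τ i + m - 1 := by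
  classical
  have h1 := (ENNReal.le_tsum (f := fun e : I × ℕ × (Fin n → ℤ) =>
    if (1 ≤ e.2.1 ∧ e.2.1 < p) ∧ (cornerBox β p a ∩ D e.1 e.2.1 e.2.2).Nonempty then
      ENNReal.ofReal ((∏ j, β j) ^ (c * (τ e.1 + e.2.1 - 1 - p))) else 0) (i, m, k))
  rw [if_pos ⟨⟨hm, hmp⟩, hne⟩] at h1
  have h2 : potential β τ D c p a < 1 := hpot.trans_lt (by simpa using hδ1)
  have h3 : ENNReal.ofReal ((∏ j, β j) ^ (c * (τ i + m - 1 - p))) < 1 := by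
    exact lt_of_le_of_lt h1 h2
  rw [ENNReal.ofReal_lt_one] at h3
  by_contra hcon
  have := Real.one_le_rpow_of_pos_of_le_one_of_nonpos hV hV1.le
    (z := c * (τ i + m - 1 - p)) (mul_nonpos_of_nonneg_of_nonpos hc.le (by linarith))
  linarith

/-- The weight used to count boxes with exponent `r` that are spoilt by a piece of
exponent `q`. -/
def spoilWeight (V c δ q r : ℝ) : ℝ := if q ≤ r then V ^ (q - r) else V ^ (c * (q - r)) / δ

-- Double counting: the pieces that meet a bad subbox have weights with sum at least 1, and a piece
-- of exponent q meets at most 4 ^ n max(1, V ^ (q - r)) subboxes, where r = p + N. The product of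
-- weight and number is bounded by 4 ^ n times `spoilWeight`.
open Classical in
theorem card_le_tsum_spoilWeight (hβ : ∀ j, 0 < β j) (hβ1 : ∀ j, β j < 1)
    (hdiam : ∀ i m, 1 ≤ m → ∀ k, ∀ x ∈ D i m k, ∀ y ∈ D i m k, ∀ j,
      |x j - y j| ≤ 2 * β j ^ (τ i + m - 1))
    (hδ : 0 < δ) (p N : ℕ) (a : Fin n → ℝ) (s : Finset (Fin n → ℤ))
    (hsub : ∀ k ∈ s, cornerBox β (p + N) (fun j => a j + 2 * β j ^ (p + N) * k j) ⊆
      cornerBox β p a)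
    (hbad : ∀ k ∈ s, ENNReal.ofReal δ <
      potential β τ D c (p + N) (fun j => a j + 2 * β j ^ (p + N) * k j)) :
    (s.card : ENNReal) ≤ ∑' e : I × ℕ × (Fin n → ℤ),
      if (1 ≤ e.2.1 ∧ e.2.1 < p + N) ∧ (cornerBox β p a ∩ D e.1 e.2.1 e.2.2).Nonempty then
        ENNReal.ofReal (4 ^ n * spoilWeight (∏ j, β j) c δ (τ e.1 + e.2.1 - 1) (p + N : ℕ))
      else 0 := by
  have hV : 0 < ∏ j, β j := Finset.prod_pos fun j _ => hβ j
  have hV1 : ∏ j, β j ≤ 1 := Finset.prod_le_one (fun j _ => (hβ j).le) fun j _ => (hβ1 j).le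
  set r := p + N with hr
  set V := ∏ j, β j with hVdef
  let ch : (Fin n → ℤ) → Set (Fin n → ℝ) :=
    fun k => cornerBox β r (fun j => a j + 2 * β j ^ r * k j)
  let q : I × ℕ × (Fin n → ℤ) → ℝ := fun e => τ e.1 + e.2.1 - 1
  let h : I × ℕ × (Fin n → ℤ) → ℝ := fun e => if q e ≤ r then 1 else V ^ (c * (q e - r)) / δ
  let hit : I × ℕ × (Fin n → ℤ) → (Fin n → ℤ) → Prop := fun e k =>
    (1 ≤ e.2.1 ∧ e.2.1 < r) ∧ (ch k ∩ D e.1 e.2.1 e.2.2).Nonempty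
  have hh0 : ∀ e, 0 ≤ h e := fun e => by
    simp only [h]; split_ifs
    · exact zero_le_one
    · positivity
  -- A piece with q ≤ r has weight 1 and suffices alone. If there is none, the sum is the potential
  -- of the subbox divided by δ.
  have h1 : ∀ k ∈ s, 1 ≤ ∑' e, if hit e k then ENNReal.ofReal (h e) else 0 := by
    intro k hk
    by_cases hbig : ∃ e, hit e k ∧ q e ≤ r
    · obtain ⟨e, he, hqe⟩ := hbig
      refine le_trans ?_ (ENNReal.le_tsum e)
      rw [if_pos he]
      simp [h, hqe]
    · push Not at hbig
      have h2 : potential β τ D c r (fun j => a j + 2 * β j ^ r * k j) =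
          ENNReal.ofReal δ * ∑' e, if hit e k then ENNReal.ofReal (h e) else 0 := by
        rw [potential, ← ENNReal.tsum_mul_left]
        refine tsum_congr fun e => ?_
        by_cases he : hit e k
        · rw [if_pos he, if_pos he, ← ENNReal.ofReal_mul hδ.le]
          simp only [h, if_neg (hbig e he).not_ge, q]
          rw [mul_div_cancel₀ _ hδ.ne']
        · rw [if_neg he, if_neg he, mul_zero]
      have h3 := hbad k hk
      rw [h2] at h3
      by_contra hlt
      push Not at hlt
      refine absurd h3 (not_lt.2 ?_)
      calc _ ≤ ENNReal.ofReal δ * 1 := by gcongr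
        _ = _ := mul_one _
  calc (s.card : ENNReal) = ∑ k ∈ s, 1 := by simp
    _ ≤ ∑ k ∈ s, ∑' e, if hit e k then ENNReal.ofReal (h e) else 0 := Finset.sum_le_sum h1
    _ = ∑' e, ∑ k ∈ s, if hit e k then ENNReal.ofReal (h e) else 0 :=
        (Summable.tsum_finsetSum fun _ _ => ENNReal.summable).symm
    _ ≤ _ := by
        refine ENNReal.tsum_le_tsum fun e => ?_
        rw [← Finset.sum_filter, Finset.sum_const, nsmul_eq_mul]
        rcases (s.filter (hit e)).eq_empty_or_nonempty with h0 | ⟨k₀, hk₀⟩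
        · simp [h0]
        · obtain ⟨hk₀s, hk₀⟩ := Finset.mem_filter.1 hk₀
          rw [if_pos ⟨hk₀.1, hk₀.2.mono (Set.inter_subset_inter_left _ (hsub k₀ hk₀s))⟩]
          have hcard := card_lattice_le hβ hβ1 r a (s.filter (hit e))
            (hdiam e.1 e.2.1 hk₀.1.1 e.2.2) fun k hk => (Finset.mem_filter.1 hk).2.2
          rw [← ENNReal.ofReal_natCast, ← ENNReal.ofReal_mul (by positivity)]
          refine ENNReal.ofReal_le_ofReal ((mul_le_mul_of_nonneg_right hcard (hh0 e)).trans ?_)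
          rw [mul_assoc]
          refine mul_le_mul_of_nonneg_left ?_ (by positivity)
          simp only [h, spoilWeight, q]
          split_ifs with hq
          · rw [mul_one]
            exact max_le (Real.one_le_rpow_of_pos_of_le_one_of_nonpos hV hV1 (by linarith)) le_rfl
          · rw [max_eq_left (Real.rpow_le_one hV.le hV1 (by linarith)), one_mul]

theorem spoilWeight_nonneg {V : ℝ} (hV : 0 < V) (hδ : 0 < δ) (q r : ℝ) :
    0 ≤ spoilWeight V c δ q r := by
  rw [spoilWeight]; split_ifs <;> positivity

/-- The right side is V ^ (-N) times the price of the piece in the parent box. If q ≤ p + N, then c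
< 1 and q > p suffice; otherwise the surplus V ^ (N (1 - c)) ≤ δ absorbs the factor 1 / δ. -/
theorem spoilWeight_le_of_lt {V : ℝ} (hV : 0 < V) (hV1 : V < 1) (hc1 : c < 1)
    (hδ : 0 < δ) {N : ℝ} (hN : V ^ (N * (1 - c)) ≤ δ) {q p : ℝ} (hq : p < q) :
    spoilWeight V c δ q (p + N) ≤ V ^ (-N) * V ^ (c * (q - p)) := by
  rw [spoilWeight]
  split_ifs
  · rw [← Real.rpow_add hV]
    exact Real.rpow_le_rpow_of_exponent_ge hV hV1.le (by nlinarith)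
  · rw [div_le_iff₀ hδ]
    calc V ^ (c * (q - (p + N))) = V ^ (-N) * V ^ (c * (q - p)) * V ^ (N * (1 - c)) := by
          rw [← Real.rpow_add hV, ← Real.rpow_add hV]; ring_nf
      _ ≤ _ := by gcongr

theorem spoilWeight_le_add {V : ℝ} (hV : 0 < V) (hδ : 0 < δ) (q r : ℝ) :
    spoilWeight V c δ q r ≤ V ^ (q - r) + V ^ (c * (q - r)) / δ := by
  have h1 : 0 < V ^ (q - r) := by positivity
  have h2 : 0 < V ^ (c * (q - r)) / δ := by positivity
  rw [spoilWeight]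
  split_ifs <;> linarith

theorem sum_Ico_rpow_le {v : ℝ} (hv : 0 < v) (hv1 : v < 1) (p N : ℕ) :
    ∑ m ∈ Finset.Ico p (p + N), v ^ (p + N - m) ≤ 1 / (1 - v) := by
  have h1 : ∑ m ∈ Finset.Ico p (p + N), v ^ (p + N - m) ≤ ∑ j ∈ Finset.range (N + 1), v ^ j := by
    rw [← Finset.sum_image (s := Finset.Ico p (p + N)) (g := fun m => p + N - m) (f := fun j => v ^ j)]
    · refine Finset.sum_le_sum_of_subset_of_nonneg ?_ fun _ _ _ => by positivity
      intro j hj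
      simp only [Finset.mem_image, Finset.mem_Ico, Finset.mem_range] at hj ⊢
      omega
    · intro x hx y hy hxy
      simp only [Finset.coe_Ico, Set.mem_Ico] at hx hy hxy
      omega
  refine h1.trans ?_
  rw [geom_sum_eq hv1.ne, ← neg_div_neg_eq, neg_sub, neg_sub]
  have := pow_pos hv (N + 1)
  exact div_le_div_of_nonneg_right (by linarith) (by linarith)

open Classical in
/-- The contribution of the pieces of exponents `m ∈ [p, p + N)`. -/
theorem tsum_new_le (hβ : ∀ j, 0 < β j) (hβ1 : ∀ j, β j < 1) (hn : 0 < n)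
    (hD : ∀ i m k, D i m k ⊆ cornerBox β m (tileCorner β m k))
    (hc1 : c < 1) (hδ : 0 < δ) {A B : ℝ} (hA0 : 0 ≤ A) (hB0 : 0 ≤ B)
    (hA : ∑' i, ENNReal.ofReal ((∏ j, β j) ^ (τ i - 1)) ≤ ENNReal.ofReal A)
    (hB : ∑' i, ENNReal.ofReal (((∏ j, β j) ^ (τ i - 1)) ^ c) ≤ ENNReal.ofReal B)
    (p N : ℕ) (a : Fin n → ℝ) (hNA : N * A ≤ δ)
    (hBδ : B ≤ δ ^ 2 * (1 - (∏ j, β j) ^ (1 - c))) :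
    (∑' e : I × ℕ × (Fin n → ℤ),
      if (p ≤ e.2.1 ∧ e.2.1 < p + N) ∧ (cornerBox β p a ∩ D e.1 e.2.1 e.2.2).Nonempty then
        ENNReal.ofReal (4 ^ n * spoilWeight (∏ j, β j) c δ (τ e.1 + e.2.1 - 1) (p + N : ℕ))
      else 0) ≤ ENNReal.ofReal (4 ^ n * (2 * 4 ^ n) * δ * (∏ j, β j) ^ (-(N : ℝ))) := by
  have hV : 0 < ∏ j, β j := Finset.prod_pos fun j _ => hβ j
  have hV1 : ∏ j, β j < 1 := prod_lt_one_of_forall_lt hn hβ hβ1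
  set V := ∏ j, β j with hVdef
  have hv : 0 < V ^ (1 - c) := by positivity
  have hv1 : V ^ (1 - c) < 1 := Real.rpow_lt_one hV.le hV1 (by linarith)
  -- the sum over the tiles
  have hk : ∀ i m, (∑' k : Fin n → ℤ,
      if (p ≤ m ∧ m < p + N) ∧ (cornerBox β p a ∩ D i m k).Nonempty then
        ENNReal.ofReal (4 ^ n * spoilWeight V c δ (τ i + m - 1) (p + N : ℕ)) else 0) ≤
      if p ≤ m ∧ m < p + N then
        ENNReal.ofReal (4 ^ n * 4 ^ n * V ^ (-(N : ℝ)) * (V ^ (τ i - 1) +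
          (V ^ (τ i - 1)) ^ c / δ * (V ^ (1 - c)) ^ (p + N - m))) else 0 := by
    intro i m
    split_ifs with hm
    · rw [ENNReal.tsum_eq_iSup_sum]
      refine iSup_le fun s => ?_
      simp only [hm, true_and, and_self]
      rw [← Finset.sum_filter, Finset.sum_const, nsmul_eq_mul]
      have hcard := card_lattice_le hβ hβ1 m 0
        (s.filter fun k => (cornerBox β p a ∩ D i m k).Nonempty) (F := cornerBox β p a) (e := p)
        (by
          intro x hx y hy j
          rw [Real.rpow_natCast, abs_le]
          have := hx.1 j; have := hx.2 j; have := hy.1 j; have := hy.2 j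
          simp only at *
          constructor <;> linarith)
        (by
          intro k hk
          obtain ⟨x, hx, hxD⟩ := (Finset.mem_filter.1 hk).2
          refine ⟨x, ?_, hx⟩
          have := hD i m k hxD
          convert this using 2
          ext j
          simp [tileCorner])
      rw [← ENNReal.ofReal_natCast, ← ENNReal.ofReal_mul (by positivity)]
      have hpm : (p : ℝ) ≤ m := by exact_mod_cast hm.1
      rw [max_eq_right (Real.one_le_rpow_of_pos_of_le_one_of_nonpos hV hV1.le (by linarith))]
        at hcard
      refine ENNReal.ofReal_le_ofReal ?_
      have hcast : ((p + N - m : ℕ) : ℝ) = p + N - m := by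
        rw [Nat.cast_sub hm.2.le]; push_cast; ring
      -- After multiplication by the number of tiles, the first term no longer depends on m, so
      -- summing over m costs a factor N. The second is geometric in p + N - m with ratio V ^ (1 -
      -- c).
      calc _ ≤ (4 ^ n * V ^ ((p : ℝ) - m)) * (4 ^ n *
            (V ^ (τ i + m - 1 - (p + N : ℕ)) + V ^ (c * (τ i + m - 1 - (p + N : ℕ))) / δ)) := by
            have := spoilWeight_le_add (c := c) hV hδ (τ i + m - 1) (p + N : ℕ)
            have := spoilWeight_nonneg (c := c) hV hδ (τ i + m - 1) (p + N : ℕ)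
            gcongr
        _ = 4 ^ n * 4 ^ n * (V ^ ((p : ℝ) - m) * V ^ (τ i + m - 1 - (p + N : ℕ)) +
            V ^ ((p : ℝ) - m) * V ^ (c * (τ i + m - 1 - (p + N : ℕ))) / δ) := by ring
        _ = 4 ^ n * 4 ^ n * (V ^ (-(N : ℝ)) * V ^ (τ i - 1) +
            V ^ (-(N : ℝ)) * ((V ^ (τ i - 1)) ^ c * (V ^ (1 - c)) ^ (p + N - m)) / δ) := by
            rw [← Real.rpow_natCast (V ^ (1 - c)), ← Real.rpow_mul hV.le, ← Real.rpow_mul hV.le,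
              hcast]
            simp only [← Real.rpow_add hV]
            push_cast
            ring_nf
        _ = _ := by ring
    · refine le_of_eq (ENNReal.tsum_eq_zero.2 fun k => if_neg ?_)
      tauto
  -- the sum over the exponents
  have hm : ∀ i, (∑' m : ℕ, ∑' k : Fin n → ℤ,
      if (p ≤ m ∧ m < p + N) ∧ (cornerBox β p a ∩ D i m k).Nonempty then
        ENNReal.ofReal (4 ^ n * spoilWeight V c δ (τ i + m - 1) (p + N : ℕ)) else 0) ≤
      ENNReal.ofReal (4 ^ n * 4 ^ n * V ^ (-(N : ℝ))) * (ENNReal.ofReal N *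
        ENNReal.ofReal (V ^ (τ i - 1)) +
        ENNReal.ofReal (1 / (δ * (1 - V ^ (1 - c)))) * ENNReal.ofReal ((V ^ (τ i - 1)) ^ c)) := by
    intro i
    refine (ENNReal.tsum_le_tsum (hk i)).trans ?_
    rw [tsum_eq_sum (s := Finset.Ico p (p + N)) fun m hm => if_neg (mt Finset.mem_Ico.2 hm),
      Finset.sum_congr rfl fun m hm => if_pos (Finset.mem_Ico.1 hm)]
    have h1v : 0 < 1 - V ^ (1 - c) := by linarith
    have hX : 0 ≤ V ^ (τ i - 1) := by positivity
    have hXc : 0 ≤ (V ^ (τ i - 1)) ^ c := by positivity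
    rw [← ENNReal.ofReal_sum_of_nonneg fun m _ => by positivity,
      ← ENNReal.ofReal_mul (by positivity), ← ENNReal.ofReal_mul (by positivity),
      ← ENNReal.ofReal_add (by positivity) (by positivity), ← ENNReal.ofReal_mul (by positivity)]
    refine ENNReal.ofReal_le_ofReal ?_
    rw [← Finset.mul_sum, Finset.sum_add_distrib, Finset.sum_const, ← Finset.mul_sum,
      Nat.card_Ico, nsmul_eq_mul, Nat.add_sub_cancel_left]
    have h2 := sum_Ico_rpow_le hv hv1 p N
    have h3 : (V ^ (τ i - 1)) ^ c / δ * ∑ m ∈ Finset.Ico p (p + N), (V ^ (1 - c)) ^ (p + N - m) ≤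
        (V ^ (τ i - 1)) ^ c / δ * (1 / (1 - V ^ (1 - c))) := by gcongr
    have h4 : (V ^ (τ i - 1)) ^ c / δ * (1 / (1 - V ^ (1 - c))) =
        1 / (δ * (1 - V ^ (1 - c))) * (V ^ (τ i - 1)) ^ c := by
      rw [div_mul_div_comm, mul_one]; ring
    rw [← h4]
    gcongr
  rw [ENNReal.tsum_prod']
  simp_rw [ENNReal.tsum_prod']
  refine (ENNReal.tsum_le_tsum hm).trans ?_
  rw [ENNReal.tsum_mul_left, ENNReal.tsum_add, ENNReal.tsum_mul_left, ENNReal.tsum_mul_left]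
  have h1v : 0 < 1 - V ^ (1 - c) := by linarith
  calc _ ≤ ENNReal.ofReal (4 ^ n * 4 ^ n * V ^ (-(N : ℝ))) * (ENNReal.ofReal N *
        ENNReal.ofReal A + ENNReal.ofReal (1 / (δ * (1 - V ^ (1 - c)))) * ENNReal.ofReal B) := by
        gcongr
    _ = ENNReal.ofReal (4 ^ n * 4 ^ n * V ^ (-(N : ℝ)) *
        (N * A + 1 / (δ * (1 - V ^ (1 - c))) * B)) := by
        rw [← ENNReal.ofReal_mul (by positivity), ← ENNReal.ofReal_mul (by positivity),
          ← ENNReal.ofReal_add (by positivity) (by positivity),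
          ← ENNReal.ofReal_mul (by positivity)]
    _ ≤ ENNReal.ofReal (4 ^ n * 4 ^ n * V ^ (-(N : ℝ)) * (δ + δ)) := by
        have : 1 / (δ * (1 - V ^ (1 - c))) * B ≤ δ := by
          rw [one_div, inv_mul_le_iff₀ (by positivity)]
          linarith
        refine ENNReal.ofReal_le_ofReal ?_
        gcongr
    _ = _ := by congr 1; ring

/-- Few of the boxes with exponent `p + N` in a box of small potential have large potential. -/
theorem card_large_potential_le (hβ : ∀ j, 0 < β j) (hβ1 : ∀ j, β j < 1) (hn : 0 < n)
    (hD : ∀ i m k, D i m k ⊆ cornerBox β m (tileCorner β m k))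
    (hdiam : ∀ i m, 1 ≤ m → ∀ k, ∀ x ∈ D i m k, ∀ y ∈ D i m k, ∀ j,
      |x j - y j| ≤ 2 * β j ^ (τ i + m - 1))
    (hc : 0 < c) (hc1 : c < 1) (hδ : 0 < δ) (hδ1 : δ < 1) {A B : ℝ} (hA0 : 0 ≤ A) (hB0 : 0 ≤ B)
    (hA : ∑' i, ENNReal.ofReal ((∏ j, β j) ^ (τ i - 1)) ≤ ENNReal.ofReal A)
    (hB : ∑' i, ENNReal.ofReal (((∏ j, β j) ^ (τ i - 1)) ^ c) ≤ ENNReal.ofReal B)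
    (p N : ℕ) (a : Fin n → ℝ) (hNA : N * A ≤ δ)
    (hBδ : B ≤ δ ^ 2 * (1 - (∏ j, β j) ^ (1 - c)))
    (hNδ : (∏ j, β j) ^ (N * (1 - c)) ≤ δ)
    (hpot : potential β τ D c p a ≤ ENNReal.ofReal δ)
    (s : Finset (Fin n → ℤ))
    (hsub : ∀ k ∈ s, cornerBox β (p + N) (fun j => a j + 2 * β j ^ (p + N) * k j) ⊆
      cornerBox β p a)
    (hbad : ∀ k ∈ s, ENNReal.ofReal δ <
      potential β τ D c (p + N) (fun j => a j + 2 * β j ^ (p + N) * k j)) :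
    (s.card : ℝ) ≤ 4 ^ n * (1 + 2 * 4 ^ n) * δ * (∏ j, β j) ^ (-(N : ℝ)) := by
  classical
  have hV : 0 < ∏ j, β j := Finset.prod_pos fun j _ => hβ j
  have hV1 : ∏ j, β j < 1 := prod_lt_one_of_forall_lt hn hβ hβ1
  have h1 := card_le_tsum_spoilWeight hβ hβ1 hdiam hδ p N a s hsub hbad
  have h2 := tsum_new_le hβ hβ1 hn hD hc1 hδ hA0 hB0 hA hB p N a hNA hBδ
  set V := ∏ j, β j with hVdef
  have h3 : ENNReal.ofReal (s.card) ≤ ENNReal.ofReal (4 ^ n * V ^ (-(N : ℝ)) * δ +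
      4 ^ n * (2 * 4 ^ n) * δ * V ^ (-(N : ℝ))) := by
    rw [ENNReal.ofReal_natCast, ENNReal.ofReal_add (by positivity) (by positivity)]
    -- Pieces of scale below p are charged to the potential of the parent, the others to the bound
    -- for new pieces.
    refine h1.trans (le_trans (b := ENNReal.ofReal (4 ^ n * V ^ (-(N : ℝ))) *
      potential β τ D c p a + _) ?_ (add_le_add ?_ h2))
    · rw [potential, ← ENNReal.tsum_mul_left, ← ENNReal.tsum_add]
      refine ENNReal.tsum_le_tsum fun e => ?_
      by_cases he : (1 ≤ e.2.1 ∧ e.2.1 < p + N) ∧ (cornerBox β p a ∩ D e.1 e.2.1 e.2.2).Nonempty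
      swap
      · rw [if_neg he]; exact zero_le
      rw [if_pos he]
      rcases lt_or_ge e.2.1 p with hm | hm
      · refine le_add_right ?_
        rw [if_pos ⟨⟨he.1.1, hm⟩, he.2⟩, ← ENNReal.ofReal_mul (by positivity)]
        refine ENNReal.ofReal_le_ofReal ?_
        rw [mul_assoc]
        refine mul_le_mul_of_nonneg_left ?_ (by positivity)
        push_cast
        exact spoilWeight_le_of_lt hV hV1 hc1 hδ hNδ
          (lt_exponent_of_potential_le hV hV1 hc hδ1 hpot he.1.1 hm he.2)
      · refine le_add_left ?_
        rw [if_pos ⟨⟨hm, he.1.2⟩, he.2⟩]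
    · rw [ENNReal.ofReal_mul (q := δ) (by positivity)]
      gcongr
  have h4 := (ENNReal.ofReal_le_ofReal_iff (by positivity)).1 h3
  linarith

end

end AffineThickness

end

/-! ### Mass distribution and trees of boxes -/

namespace AffineThickness

open MeasureTheory Filter Topology

/-- The mass distribution principle. -/
theorem ofReal_le_dimH_of_measure_closedBall_le {X : Type*} [MetricSpace X] [MeasurableSpace X]
    [BorelSpace X] (μ : Measure X) {S : Set X} (hS : μ S ≠ 0) {K R d : ℝ} (hK : 0 < K)
    (hR : 0 < R) (h : ∀ x r, 0 < r → r < R → μ (Metric.closedBall x r) ≤ ENNReal.ofReal (K * r ^ d)) :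
    ENNReal.ofReal d ≤ dimH S := by
  rcases le_or_gt d 0 with hd | hd
  · simp [ENNReal.ofReal_of_nonpos hd]
  have hle : (ENNReal.ofReal K)⁻¹ • μ ≤ μH[d] := by
    refine Measure.le_hausdorffMeasure d _ (ENNReal.ofReal (R / 2))
      (ENNReal.ofReal_pos.2 (by linarith)) fun s hs => ?_
    rcases s.eq_empty_or_nonempty with rfl | ⟨x, hx⟩
    · simp
    have hfin : Metric.ediam s ≠ ⊤ := ne_top_of_le_ne_top ENNReal.ofReal_ne_top hs
    set D := (Metric.ediam s).toReal with hD
    have hD0 : 0 ≤ D := ENNReal.toReal_nonneg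
    have hDe : Metric.ediam s = ENNReal.ofReal D := (ENNReal.ofReal_toReal hfin).symm
    have hDR : D < R := by
      rw [hDe, ENNReal.ofReal_le_ofReal_iff (by linarith)] at hs
      linarith
    -- The diameter D may be 0 while balls need a positive radius, hence the limit r ↓ D. The bound
    -- R / 2 on the diameter leaves room for D < r < R.
    have h1 : μ s ≤ ENNReal.ofReal (K * D ^ d) := by
      have ht : Tendsto (fun r : ℝ => ENNReal.ofReal (K * r ^ d)) (𝓝[>] D)
          (𝓝 (ENNReal.ofReal (K * D ^ d))) := by
        have : Continuous fun r : ℝ => ENNReal.ofReal (K * r ^ d) :=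
          ENNReal.continuous_ofReal.comp
            (continuous_const.mul (Real.continuous_rpow_const hd.le))
        exact this.continuousAt.tendsto.mono_left nhdsWithin_le_nhds
      refine ge_of_tendsto ht ?_
      filter_upwards [Ioo_mem_nhdsGT hDR] with r hr
      refine (measure_mono fun y hy => ?_).trans (h x r (hD0.trans_lt hr.1) hr.2)
      rw [Metric.mem_closedBall, dist_edist]
      exact (ENNReal.toReal_mono hfin (Metric.edist_le_ediam_of_mem hy hx)).trans hr.1.le
    rw [Measure.smul_apply, smul_eq_mul, hDe, ENNReal.ofReal_rpow_of_nonneg hD0 hd.le]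
    calc _ ≤ (ENNReal.ofReal K)⁻¹ * ENNReal.ofReal (K * D ^ d) := by gcongr
      _ = _ := by
        rw [ENNReal.ofReal_mul hK.le, ← mul_assoc, ENNReal.inv_mul_cancel, one_mul]
        · exact (ENNReal.ofReal_pos.2 hK).ne'
        · exact ENNReal.ofReal_ne_top
  refine le_dimH_of_hausdorffMeasure_ne_zero (d := d.toNNReal) fun h0 => ?_
  rw [Real.coe_toNNReal d hd.le] at h0
  have h1 := hle S
  rw [h0, Measure.smul_apply, smul_eq_mul, nonpos_iff_eq_zero, mul_eq_zero] at h1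
  rcases h1 with h1 | h1
  · exact ENNReal.ofReal_ne_top (ENNReal.inv_eq_zero.1 h1)
  · exact hS h1

section Tree

variable {n M : ℕ}

/-- The lower corner of the `j`-th box along the branch `ω` of a tree of boxes. -/
def node (f : ℕ → (Fin n → ℝ) → Fin M → Fin n → ℝ) (a₀ : Fin n → ℝ) (ω : ℕ → Fin M) :
    ℕ → Fin n → ℝ
  | 0 => a₀
  | j + 1 => f j (node f a₀ ω j) (ω j)

variable {f : ℕ → (Fin n → ℝ) → Fin M → Fin n → ℝ} {a₀ : Fin n → ℝ} {P : ℕ → (Fin n → ℝ) → Prop}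
  {l : ℕ → Fin n → ℝ}

theorem node_congr {ω ω' : ℕ → Fin M} {j : ℕ} (h : ∀ i < j, ω i = ω' i) :
    node f a₀ ω j = node f a₀ ω' j := by
  induction j with
  | zero => rfl
  | succ j ih => rw [node, node, ih fun i hi => h i (by omega), h j (by omega)]

/-- A node depends on finitely many choices only. This makes the limit map on branches measurable.
-/
theorem isLocallyConstant_node (j : ℕ) : IsLocallyConstant fun ω => node f a₀ ω j := by
  induction j with
  | zero => exact IsLocallyConstant.const a₀
  | succ j ih =>
    have h1 : IsLocallyConstant fun ω : ℕ → Fin M => ω j :=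
      (IsLocallyConstant.iff_continuous _).2 (continuous_apply j)
    exact ih.comp₂ h1 (f j)

theorem node_prop (h₀ : P 0 a₀) (hP : ∀ j a, P j a → ∀ t, P (j + 1) (f j a t)) (ω : ℕ → Fin M)
    (j : ℕ) : P j (node f a₀ ω j) := by
  induction j with
  | zero => exact h₀
  | succ j ih => exact hP j _ ih _

/-- Two branches enter disjoint children at the first level where they differ, and nesting preserves
this. Half-open boxes allow neighbours to share a face. -/
theorem disjoint_node (h₀ : P 0 a₀) (hP : ∀ j a, P j a → ∀ t, P (j + 1) (f j a t))
    (hsub : ∀ j a, P j a → ∀ t x, a x ≤ f j a t x ∧ f j a t x + l (j + 1) x ≤ a x + l j x)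
    (hdisj : ∀ j a, P j a → ∀ t t', t ≠ t' →
      Disjoint (Set.univ.pi fun x => Set.Ico (f j a t x) (f j a t x + l (j + 1) x))
        (Set.univ.pi fun x => Set.Ico (f j a t' x) (f j a t' x + l (j + 1) x)))
    {ω ω' : ℕ → Fin M} {j : ℕ} (h : ∃ i < j, ω i ≠ ω' i) :
    Disjoint (Set.univ.pi fun x => Set.Ico (node f a₀ ω j x) (node f a₀ ω j x + l j x))
      (Set.univ.pi fun x => Set.Ico (node f a₀ ω' j x) (node f a₀ ω' j x + l j x)) := by
  induction j with
  | zero => obtain ⟨i, hi, -⟩ := h; omega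
  | succ j ih =>
    have hsub' : ∀ ω : ℕ → Fin M, (Set.univ.pi fun x =>
        Set.Ico (node f a₀ ω (j + 1) x) (node f a₀ ω (j + 1) x + l (j + 1) x)) ⊆
        Set.univ.pi fun x => Set.Ico (node f a₀ ω j x) (node f a₀ ω j x + l j x) := by
      intro ω
      refine Set.pi_mono fun x _ => ?_
      have := hsub j _ (node_prop h₀ hP ω j) (ω j) x
      exact Set.Ico_subset_Ico this.1 this.2
    by_cases h' : ∃ i < j, ω i ≠ ω' i
    · exact (ih h').mono (hsub' ω) (hsub' ω')
    · push Not at h'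
      obtain ⟨i, hi, hne⟩ := h
      have hij : i = j := by
        by_contra hij
        exact hne (h' i (by omega))
      subst hij
      simp only [node, node_congr (f := f) (a₀ := a₀) h']
      exact hdisj i _ (node_prop h₀ hP ω' i) _ _ hne

/-- A tree of boxes with many branches yields a set of large dimension. -/
theorem nonempty_and_le_dimH_of_tree {κ ρ R W : ℝ} (hκ : 0 < κ) (hκ1 : κ < 1) (hρ : 0 < ρ)
    (hρ1 : ρ < 1) (hR : 0 < R) (hW : 0 < W) (hl : ∀ j x, 0 < l j x) (hlR : ∀ j x, l j x ≤ R * ρ ^ j)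
    (hM : ∀ j : ℕ, W * κ ^ j ≤ (∏ x, l j x) * (M : ℝ) ^ j)
    (h₀ : P 0 a₀)
    (hstep : ∀ j a, P j a → ∃ f : Fin M → Fin n → ℝ, (∀ t, P (j + 1) (f t)) ∧
      (∀ t x, a x ≤ f t x ∧ f t x + l (j + 1) x ≤ a x + l j x) ∧
      ∀ t t', t ≠ t' → Disjoint (Set.univ.pi fun x => Set.Ico (f t x) (f t x + l (j + 1) x))
        (Set.univ.pi fun x => Set.Ico (f t' x) (f t' x + l (j + 1) x)))
    {S : Set (Fin n → ℝ)}
    (hS : ∀ x (a : ℕ → Fin n → ℝ), a 0 = a₀ → (∀ j, P j (a j)) →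
      (∀ j, x ∈ Set.Icc (a j) (fun i => a j i + l j i)) → x ∈ S) :
    S.Nonempty ∧ ENNReal.ofReal (n - Real.log κ / Real.log ρ) ≤ dimH S := by
  classical
  choose! f hP hsub hdisj using hstep
  have hM0 : 0 < M := by
    have := hM 1
    rcases Nat.eq_zero_or_pos M with h | h
    · have h2 : 0 < W * κ ^ 1 := by positivity
      rw [h] at this
      simp at this h2
      linarith
    · exact h
  have : Nonempty (Fin M) := ⟨⟨0, hM0⟩⟩
  have hMR : (0 : ℝ) < M := by exact_mod_cast hM0
  have hmono : ∀ ω x, Monotone fun j => node f a₀ ω j x := fun ω x =>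
    monotone_nat_of_le_succ fun j => (hsub j _ (node_prop h₀ hP ω j) (ω j) x).1
  have hanti : ∀ ω x, Antitone fun j => node f a₀ ω j x + l j x := fun ω x =>
    antitone_nat_of_succ_le fun j => (hsub j _ (node_prop h₀ hP ω j) (ω j) x).2
  let π : (ℕ → Fin M) → Fin n → ℝ := fun ω x => ⨆ j, node f a₀ ω j x
  have hπ : ∀ ω j x, π ω x ∈ Set.Icc (node f a₀ ω j x) (node f a₀ ω j x + l j x) := fun ω j x =>
    Set.mem_iInter.1 ((hmono ω x).ciSup_mem_iInter_Icc_of_antitone (hanti ω x)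
      fun j => le_add_of_nonneg_right (hl j x).le) j
  have hπS : ∀ ω, π ω ∈ S := fun ω => hS _ (node f a₀ ω) rfl (node_prop h₀ hP ω)
    fun j => ⟨fun x => (hπ ω j x).1, fun x => (hπ ω j x).2⟩
  have hπm : Measurable π := by
    refine measurable_of_tendsto_metrizable (f := fun j ω => node f a₀ ω j)
      (fun j => (isLocallyConstant_node j).continuous.measurable) ?_
    rw [tendsto_pi_nhds]
    intro ω
    rw [tendsto_pi_nhds]
    intro x
    refine tendsto_atTop_ciSup (hmono ω x) ⟨node f a₀ ω 0 x + l 0 x, ?_⟩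
    rintro _ ⟨j, rfl⟩
    have h1 := hanti ω x (Nat.zero_le j)
    have h2 := hl j x
    simp only at h1 ⊢
    linarith
  refine ⟨⟨_, hπS fun _ => ⟨0, hM0⟩⟩, ?_⟩
  -- The mass is spread uniformly over the branches, so each box of level j stands for a cylinder of
  -- measure M ^ (-j).
  let u : Measure (Fin M) := (PMF.uniformOfFintype (Fin M)).toMeasure
  let μ₀ : Measure (ℕ → Fin M) := Measure.infinitePi fun _ => u
  have hcyl : ∀ (ω : ℕ → Fin M) (j : ℕ), μ₀ {ω' | ∀ i < j, ω' i = ω i} =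
      ENNReal.ofReal (((M : ℝ) ^ j)⁻¹) := by
    intro ω j
    have h1 : {ω' : ℕ → Fin M | ∀ i < j, ω' i = ω i} =
        Set.pi (Finset.range j) fun i => {ω i} := by
      ext ω'; simp
    rw [h1, Measure.infinitePi_pi _ fun i _ => measurableSet_singleton _]
    have h2 : ∀ t, u {t} = (M : ENNReal)⁻¹ := fun t => by
      simp only [u]
      rw [PMF.toMeasure_apply_singleton _ _ (measurableSet_singleton _)]
      simp
    simp only [h2, Finset.prod_const, Finset.card_range]
    rw [ENNReal.ofReal_inv_of_pos (by positivity), ENNReal.ofReal_pow hMR.le,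
      ENNReal.ofReal_natCast, ENNReal.inv_pow]
  -- the measure of a ball
  have hball : ∀ (z : Fin n → ℝ) (r : ℝ) (j : ℕ), 0 < r → R * ρ ^ j ≤ r →
      μ₀.map π (Metric.closedBall z r) ≤ ENNReal.ofReal (6 ^ n * r ^ n / (W * κ ^ j)) := by
    intro z r j hr hj
    -- The default value 0 is immaterial: the node at level j sees only the first j choices.
    let ext : (Fin j → Fin M) → ℕ → Fin M := fun w i => if h : i < j then w ⟨i, h⟩ else ⟨0, hM0⟩
    let F : Finset (Fin j → Fin M) := Finset.univ.filter fun w =>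
      (Set.Icc (node f a₀ (ext w) j) (fun x => node f a₀ (ext w) j x + l j x) ∩
        Metric.closedBall z r).Nonempty
    have hext : ∀ w i (hi : i < j), ext w i = w ⟨i, hi⟩ := fun w i hi => dif_pos hi
    have hcard : (F.card : ℝ) * ∏ x, l j x ≤ 6 ^ n * r ^ n := by
      refine (card_mul_prod_le_of_meets F (fun w => node f a₀ (ext w) j) (fun x => (hl j x).le)
        (d := fun _ => 2 * r) (fun _ => by positivity) ?_ (F := Metric.closedBall z r) ?_
        fun w hw => (Finset.mem_filter.1 hw).2).trans ?_
      · intro w _ w' _ hne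
        refine disjoint_node h₀ hP hsub hdisj ?_
        obtain ⟨i, hi⟩ := Function.ne_iff.1 hne
        refine ⟨i, i.2, ?_⟩
        rwa [hext w i i.2, hext w' i i.2]
      · intro x hx y hy i
        have h1 := (dist_le_pi_dist x z i).trans hx
        have h2 := (dist_le_pi_dist y z i).trans hy
        rw [Real.dist_eq, abs_le] at h1 h2
        rw [abs_le]
        constructor <;> linarith [h1.1, h1.2, h2.1, h2.2]
      -- Each factor is 2 (2 r) + 2 l with l ≤ R ρ ^ j ≤ r.
      · calc _ ≤ ∏ _x : Fin n, 6 * r := by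
              refine Finset.prod_le_prod (fun x _ => ?_) fun x _ => ?_
              · have := hl j x; positivity
              · have := hlR j x; linarith
          _ = _ := by rw [Finset.prod_const, Finset.card_univ, Fintype.card_fin, mul_pow]
    rw [Measure.map_apply hπm Metric.isClosed_closedBall.measurableSet]
    have hcover : π ⁻¹' Metric.closedBall z r ⊆ ⋃ w ∈ F, {ω' | ∀ i < j, ω' i = ext w i} := by
      intro ω hω
      have hag : ∀ i < j, ω i = ext (fun i => ω i) i := fun i hi => (hext (fun i => ω i) i hi).symm
      refine Set.mem_biUnion (x := fun i : Fin j => ω i) ?_ hag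
      refine Finset.mem_coe.2 (Finset.mem_filter.2 ⟨Finset.mem_univ _, π ω, ?_, hω⟩)
      rw [← node_congr hag]
      exact ⟨fun x => (hπ ω j x).1, fun x => (hπ ω j x).2⟩
    refine (measure_mono hcover).trans ((measure_biUnion_finset_le _ _).trans ?_)
    simp only [hcyl, Finset.sum_const, nsmul_eq_mul]
    rw [← ENNReal.ofReal_natCast, ← ENNReal.ofReal_mul (by positivity)]
    refine ENNReal.ofReal_le_ofReal ?_
    have hpl : 0 < ∏ x, l j x := Finset.prod_pos fun x _ => hl j x
    rw [← div_eq_mul_inv, div_le_div_iff₀ (by positivity) (by positivity)]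
    calc (F.card : ℝ) * (W * κ ^ j) ≤ F.card * ((∏ x, l j x) * (M : ℝ) ^ j) := by
          exact mul_le_mul_of_nonneg_left (hM j) (Nat.cast_nonneg _)
      _ = (F.card * ∏ x, l j x) * (M : ℝ) ^ j := by ring
      _ ≤ _ := by gcongr
  set ε := Real.log κ / Real.log ρ with hε
  have hlogρ : Real.log ρ < 0 := Real.log_neg hρ hρ1
  have hε0 : 0 ≤ ε := div_nonneg_of_nonpos (Real.log_neg hκ hκ1).le hlogρ.le
  have hκρ : κ = ρ ^ ε := by
    rw [Real.rpow_def_of_pos hρ, hε, mul_div_cancel₀ _ hlogρ.ne, Real.exp_log hκ]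
  -- The least j with R ρ ^ j ≤ r satisfies ρ ^ j ≥ r ρ / R, and κ ^ j = (ρ ^ j) ^ ε; this produces
  -- K.
  refine ofReal_le_dimH_of_measure_closedBall_le (μ₀.map π) (S := S) ?_
    (K := 6 ^ n / W * (ρ / R) ^ (-ε)) (by positivity) hR ?_
  · have h1 := Measure.le_map_apply (μ := μ₀) hπm.aemeasurable S
    have h2 : π ⁻¹' S = Set.univ := Set.eq_univ_of_forall hπS
    rw [h2, measure_univ] at h1
    exact (lt_of_lt_of_le one_pos h1).ne'
  · intro z r hr hrR
    have hex : ∃ j : ℕ, R * ρ ^ j ≤ r := by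
      obtain ⟨j, hj⟩ := exists_pow_lt_of_lt_one (div_pos hr hR) hρ1
      exact ⟨j, by rw [lt_div_iff₀ hR] at hj; linarith⟩
    have hj := Nat.find_spec hex
    have hmin := fun j' => Nat.find_min (m := j') hex
    set j := Nat.find hex
    have hj0 : j ≠ 0 := by
      intro h
      rw [h] at hj
      simp at hj
      linarith
    obtain ⟨i, hi⟩ := Nat.exists_eq_succ_of_ne_zero hj0
    have hlow := hmin i (by omega)
    push Not at hlow
    refine (hball z r j hr hj).trans (ENNReal.ofReal_le_ofReal ?_)
    have h1 : r * (ρ / R) ≤ ρ ^ j := by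
      rw [hi, pow_succ, mul_div_assoc', div_le_iff₀ hR]
      nlinarith
    have h2 : (κ ^ j)⁻¹ ≤ (r * (ρ / R)) ^ (-ε) := by
      rw [hκρ, ← Real.rpow_natCast, ← Real.rpow_mul hρ.le, mul_comm ε, Real.rpow_mul hρ.le,
        Real.rpow_natCast, ← Real.rpow_neg (by positivity)]
      exact Real.rpow_le_rpow_of_nonpos (by positivity) h1 (by linarith)
    calc 6 ^ n * r ^ n / (W * κ ^ j) = 6 ^ n / W * r ^ n * (κ ^ j)⁻¹ := by
          field_simp
      _ ≤ 6 ^ n / W * r ^ n * (r * (ρ / R)) ^ (-ε) := by gcongr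
      _ = _ := by
          rw [Real.mul_rpow hr.le (by positivity), sub_eq_add_neg, Real.rpow_add hr,
            Real.rpow_natCast]
          ring

end Tree

end AffineThickness

/-! ### Good children of a good box, and estimates for the parameters -/

namespace AffineThickness

section

variable {n : ℕ} {I : Type*} {β : Fin n → ℝ} {τ : I → ℝ}
  {D : I → ℕ → (Fin n → ℤ) → Set (Fin n → ℝ)} {c δ : ℝ}

/-- A box of small potential contains many disjoint boxes of small potential. -/
theorem exists_small_potential_boxes (hβ : ∀ j, 0 < β j) (hβ1 : ∀ j, β j < 1) (hn : 0 < n)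
    (hD : ∀ i m k, D i m k ⊆ cornerBox β m (tileCorner β m k))
    (hdiam : ∀ i m, 1 ≤ m → ∀ k, ∀ x ∈ D i m k, ∀ y ∈ D i m k, ∀ j,
      |x j - y j| ≤ 2 * β j ^ (τ i + m - 1))
    (hc : 0 < c) (hc1 : c < 1) (hδ : 0 < δ) (hδ1 : δ < 1) {A B : ℝ} (hA0 : 0 ≤ A) (hB0 : 0 ≤ B)
    (hA : ∑' i, ENNReal.ofReal ((∏ j, β j) ^ (τ i - 1)) ≤ ENNReal.ofReal A)
    (hB : ∑' i, ENNReal.ofReal (((∏ j, β j) ^ (τ i - 1)) ^ c) ≤ ENNReal.ofReal B)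
    (p N : ℕ) (a : Fin n → ℝ) (hNA : N * A ≤ δ)
    (hBδ : B ≤ δ ^ 2 * (1 - (∏ j, β j) ^ (1 - c)))
    (hNδ : (∏ j, β j) ^ (N * (1 - c)) ≤ δ)
    (hpot : potential β τ D c p a ≤ ENNReal.ofReal δ) {M : ℕ}
    (hM : (M : ℝ) ≤ Nat.ceil (((∏ j, (1 - β j ^ N)) - 4 ^ n * (1 + 2 * 4 ^ n) * δ) *
      (∏ j, β j) ^ (-(N : ℝ)))) :
    ∃ f : Fin M → Fin n → ℝ,
      (∀ t, potential β τ D c (p + N) (f t) ≤ ENNReal.ofReal δ) ∧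
      (∀ t x, a x ≤ f t x ∧ f t x + 2 * β x ^ (p + N) ≤ a x + 2 * β x ^ p) ∧
      ∀ t t', t ≠ t' →
        Disjoint (Set.univ.pi fun x => Set.Ico (f t x) (f t x + 2 * β x ^ (p + N)))
          (Set.univ.pi fun x => Set.Ico (f t' x) (f t' x + 2 * β x ^ (p + N))) := by
  classical
  have hV : 0 < ∏ j, β j := Finset.prod_pos fun j _ => hβ j
  -- Rounding down loses at most one subbox per direction, which leaves at least (1 - β x ^ N) (β x
  -- ^ N)⁻¹ of them.
  let K : Fin n → ℕ := fun x => ⌊(β x ^ N)⁻¹⌋₊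
  let ch : Finset (Fin n → ℤ) := Fintype.piFinset fun x => Finset.Ico (0 : ℤ) (K x)
  let cor : (Fin n → ℤ) → Fin n → ℝ := fun k x => a x + 2 * β x ^ (p + N) * k x
  have hin : ∀ k ∈ ch, ∀ x, a x ≤ cor k x ∧ cor k x + 2 * β x ^ (p + N) ≤ a x + 2 * β x ^ p := by
    intro k hk x
    obtain ⟨h0, h1⟩ := Finset.mem_Ico.1 (Fintype.mem_piFinset.1 hk x)
    have h0' : (0 : ℝ) ≤ k x := by exact_mod_cast h0
    have h1' : (k x : ℝ) + 1 ≤ K x := by exact_mod_cast h1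
    have hb : 0 < β x ^ N := pow_pos (hβ x) N
    have hbp : 0 < β x ^ p := pow_pos (hβ x) p
    have h2 : (K x : ℝ) ≤ (β x ^ N)⁻¹ := Nat.floor_le (by positivity)
    have h3 : β x ^ N * (k x + 1) ≤ 1 := by
      calc β x ^ N * (k x + 1) ≤ β x ^ N * (β x ^ N)⁻¹ := by gcongr; linarith
        _ = 1 := mul_inv_cancel₀ hb.ne'
    simp only [cor, pow_add]
    constructor
    · have : 0 ≤ 2 * (β x ^ p * β x ^ N) * k x := by positivity
      linarith
    · nlinarith
  have hsub : ∀ k ∈ ch, cornerBox β (p + N) (cor k) ⊆ cornerBox β p a := fun k hk =>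
    Set.Icc_subset_Icc (fun x => (hin k hk x).1) fun x => (hin k hk x).2
  let good := ch.filter fun k => potential β τ D c (p + N) (cor k) ≤ ENNReal.ofReal δ
  let bad := ch.filter fun k => ¬ potential β τ D c (p + N) (cor k) ≤ ENNReal.ofReal δ
  have hcard : (good.card : ℝ) + bad.card = ch.card := by
    exact_mod_cast Finset.card_filter_add_card_filter_not (s := ch) _
  have hbad : (bad.card : ℝ) ≤ 4 ^ n * (1 + 2 * 4 ^ n) * δ * (∏ j, β j) ^ (-(N : ℝ)) :=
    card_large_potential_le hβ hβ1 hn hD hdiam hc hc1 hδ hδ1 hA0 hB0 hA hB p N a hNA hBδ hNδ hpot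
      bad (fun k hk => hsub k (Finset.mem_filter.1 hk).1)
      fun k hk => not_le.1 (Finset.mem_filter.1 hk).2
  have hch : (∏ j, (1 - β j ^ N)) * (∏ j, β j) ^ (-(N : ℝ)) ≤ ch.card := by
    rw [Fintype.card_piFinset, ← Real.finsetProd_rpow _ _ fun j _ => (hβ j).le,
      ← Finset.prod_mul_distrib]
    push_cast
    refine Finset.prod_le_prod (fun x _ => ?_) fun x _ => ?_
    · have := pow_le_one₀ (n := N) (hβ x).le (hβ1 x).le
      exact mul_nonneg (by linarith) (Real.rpow_nonneg (hβ x).le _)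
    · have hb : 0 < β x ^ N := pow_pos (hβ x) N
      rw [Real.rpow_neg (hβ x).le, Real.rpow_natCast, sub_mul, one_mul, mul_inv_cancel₀ hb.ne']
      have := Nat.lt_floor_add_one (β x ^ N)⁻¹
      simp only [Int.card_Ico, sub_zero, Int.toNat_natCast, K]
      linarith
  have hMgood : Fintype.card (Fin M) ≤ Fintype.card good := by
    rw [Fintype.card_fin, Fintype.card_coe]
    refine (Nat.cast_le.1 hM).trans (Nat.ceil_le.2 ?_)
    linarith
  obtain ⟨g⟩ := Function.Embedding.nonempty_of_card_le hMgood
  refine ⟨fun t => cor (g t), fun t => (Finset.mem_filter.1 (g t).2).2,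
    fun t => hin _ (Finset.mem_filter.1 (g t).2).1, fun t t' htt => ?_⟩
  exact pairwiseDisjoint_lattice (l := fun x => 2 * β x ^ (p + N)) (b := a)
    (fun x => by have := hβ x; positivity) Set.univ
    trivial trivial fun h => htt (g.injective (Subtype.ext h))

/-- Each term is at most α, so f = f ^ (1 - c) f ^ c ≤ α ^ (1 - c) f ^ c, and this sums to α. -/
theorem tsum_ofReal_le_of_hasSum_rpow {f : I → ℝ} {α : ℝ} (hf : ∀ i, 0 < f i) (hα : 0 < α)
    (hc : 0 < c) (hc1 : c < 1) (hsum : HasSum (fun i => f i ^ c) (α ^ c)) :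
    ∑' i, ENNReal.ofReal (f i) ≤ ENNReal.ofReal α := by
  have h1 : ∀ i, f i ≤ α := fun i =>
    (Real.rpow_le_rpow_iff (hf i).le hα.le hc).1
      (le_hasSum hsum i fun j _ => Real.rpow_nonneg (hf j).le c)
  have h2 : ∀ i, f i ≤ α ^ (1 - c) * f i ^ c := fun i => by
    calc f i = f i ^ (1 - c) * f i ^ c := by
          rw [← Real.rpow_add (hf i)]; simp
      _ ≤ _ := mul_le_mul_of_nonneg_right
          (Real.rpow_le_rpow (hf i).le (h1 i) (by linarith)) (Real.rpow_nonneg (hf i).le c)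
  have h3 := hsum.mul_left (α ^ (1 - c))
  calc _ ≤ ∑' i, ENNReal.ofReal (α ^ (1 - c) * f i ^ c) :=
        ENNReal.tsum_le_tsum fun i => ENNReal.ofReal_le_ofReal (h2 i)
    _ = ENNReal.ofReal (α ^ (1 - c) * α ^ c) := by
        rw [← h3.tsum_eq, ENNReal.ofReal_tsum_of_nonneg (fun i => ?_) h3.summable]
        have := hf i
        positivity
    _ = _ := by rw [← Real.rpow_add hα]; simp

/-- With v = V ^ (1 - c), the hypotheses give 1 - v ≥ α / δ ^ 2, hence N (1 - v) ≥ 1 / (2 δ) and v ^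
N ≤ exp (-1 / (2 δ)). The quadratic term of exp brings this below δ once δ ≤ 1 / 8. -/
theorem rpow_floor_le {V α : ℝ} {N : ℕ} (hV : 0 < V) (hα : 0 < α) (hα1 : α < 1)
    (hc1 : c < 1) (hδ : 0 < δ) (hδ8 : δ ≤ 1 / 8)
    (hαc : α ^ c ≤ δ ^ 2 * (1 - V ^ (1 - c))) (hN : δ / (2 * α) ≤ N) :
    V ^ (N * (1 - c)) ≤ δ := by
  have hv : 0 < V ^ (1 - c) := by positivity
  have h1 : V ^ (N * (1 - c)) = (V ^ (1 - c)) ^ N := by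
    rw [mul_comm, Real.rpow_mul hV.le, Real.rpow_natCast]
  have h2 : V ^ (1 - c) ≤ Real.exp (-(1 - V ^ (1 - c))) := by
    have := Real.add_one_le_exp (-(1 - V ^ (1 - c)))
    linarith
  have h3 : 1 / (2 * δ) ≤ N * (1 - V ^ (1 - c)) := by
    have h4 : α ≤ α ^ c := by
      simpa using Real.rpow_le_rpow_of_exponent_ge hα hα1.le hc1.le
    have h5 : α / δ ^ 2 ≤ 1 - V ^ (1 - c) := by
      rw [div_le_iff₀ (by positivity)]; linarith
    calc 1 / (2 * δ) = δ / (2 * α) * (α / δ ^ 2) := by field_simp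
      _ ≤ _ := by gcongr
  have h6 : δ⁻¹ ≤ Real.exp (1 / (2 * δ)) := by
    have h7 := Real.quadratic_le_exp_of_nonneg (x := 1 / (2 * δ)) (by positivity)
    have h8 : 8 ≤ δ⁻¹ := by
      rw [le_inv_comm₀ (by norm_num) hδ]; linarith
    have h9 : 1 / (2 * δ) = δ⁻¹ / 2 := by field_simp
    rw [h9] at h7 ⊢
    nlinarith
  rw [h1]
  calc (V ^ (1 - c)) ^ N ≤ Real.exp (-(1 - V ^ (1 - c))) ^ N := by gcongr
    _ = (Real.exp (N * (1 - V ^ (1 - c))))⁻¹ := by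
        rw [← Real.exp_nat_mul, ← Real.exp_neg]; ring_nf
    _ ≤ (Real.exp (1 / (2 * δ)))⁻¹ := by gcongr
    _ ≤ (δ⁻¹)⁻¹ := by gcongr
    _ = δ := inv_inv δ

theorem alphaOf_eq (hβ : ∀ j, 0 < β j) (t : ℝ) : alphaOf β t = (∏ j, β j) ^ (t - 1) := by
  rw [alphaOf, Real.finsetProd_rpow _ _ fun j _ => (hβ j).le]

theorem kappa_eq {α : ℝ} (hα : 0 < α) (hδ : 0 < δ) : kappa β δ α =
    (∏ j, (1 / 3 : ℝ) * (1 - 5 * β j ^ ⌊δ * α⁻¹⌋₊)) - 8 ^ n * (1 + 2 ^ (2 * n + 1)) * δ := by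
  have : ⌊δ * α⁻¹⌋ = (⌊δ * α⁻¹⌋₊ : ℤ) := (Int.natCast_floor_eq_floor (by positivity)).symm
  simp only [kappa, this, zpow_natCast]

end

end AffineThickness

/-! ### Assembly: choice of the tree and the final bound -/

theorem mainTheorem7 {n : ℕ} (hn : 0 < n) (β : Fin n → ℝ)
    (hβ : ∀ j, β j ∈ Set.Ioo (0 : ℝ) (1 / 5))
    {I : Type*} [Countable I] (C : I → Set (Fin n → ℝ))
    (hC : ∀ i, IsCompact (C i)) (hCB : ∀ i, C i ⊆ Metric.closedBall 0 1)
    (J : I → Set ℕ) (G : I → ℕ → Set (Fin n → ℝ))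
    (hG : ∀ i, AffineThickness.IsOrderedGaps β (C i) (J i) (G i))
    (hτ_top : ∀ i, AffineThickness.thickness β (C i) (J i) (G i) ≠ ⊤)
    (hτ_bot : ∀ i, AffineThickness.thickness β (C i) (J i) (G i) ≠ ⊥)
    (α c δ : ℝ) (hα : α ∈ Set.Ioo (0 : ℝ) 1) (hc : c ∈ Set.Ioo (0 : ℝ) 1)
    (hδ : δ ∈ Set.Ioo (0 : ℝ) 1)
    (hsum : HasSum (fun i => (AffineThickness.alphaOf β
      (AffineThickness.thickness β (C i) (J i) (G i)).toReal) ^ c) (α ^ c))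
    (hαc : α ^ c ≤ δ ^ 2 * (1 - (∏ j, β j) ^ (1 - c)))
    (hlt : δ ^ 2 * (1 - (∏ j, β j) ^ (1 - c)) < 1)
    (hκ : 0 < AffineThickness.kappa β δ α) :
    ∀ y : Fin n → ℝ,
      ((⋂ i, (C i ∪ AffineThickness.unboundedGap (C i))) ∩
        ((fun x => Matrix.mulVec (Matrix.diagonal β) x + y) ''
          Metric.closedBall (0 : Fin n → ℝ) 1)).Nonempty ∧
      ENNReal.ofReal (max ((n : ℝ) -
          AffineThickness.K₁ β δ α * (α / |Real.log (⨆ j, β j)|)) 0) ≤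
        dimH ((⋂ i, (C i ∪ AffineThickness.unboundedGap (C i))) ∩
          ((fun x => Matrix.mulVec (Matrix.diagonal β) x + y) ''
            Metric.closedBall (0 : Fin n → ℝ) 1)) := by
  open AffineThickness in
  intro y
  obtain ⟨hα0, hα1⟩ := hα
  obtain ⟨hc0, hc1⟩ := hc
  obtain ⟨hδ0, hδ1⟩ := hδ
  have hβ0 : ∀ j, 0 < β j := fun j => (hβ j).1
  have hβ5 : ∀ j, β j < 1 / 5 := fun j => (hβ j).2
  have hβ1 : ∀ j, β j < 1 := fun j => (hβ5 j).trans (by norm_num)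
  have hV : 0 < ∏ j, β j := Finset.prod_pos fun j _ => hβ0 j
  have hV1 : ∏ j, β j < 1 := prod_lt_one_of_forall_lt hn hβ0 hβ1
  have hv : 0 < (∏ j, β j) ^ (1 - c) := by positivity
  set τ : I → ℝ := fun i => (thickness β (C i) (J i) (G i)).toReal with hτdef
  simp only [alphaOf_eq hβ0] at hsum
  have hα_pos : ∀ i, 0 < (∏ j, β j) ^ (τ i - 1) := fun i => Real.rpow_pos_of_pos hV _
  have hA := tsum_ofReal_le_of_hasSum_rpow hα_pos hα0 hc0 hc1 hsum
  have hB : ∑' i, ENNReal.ofReal (((∏ j, β j) ^ (τ i - 1)) ^ c) ≤ ENNReal.ofReal (α ^ c) := by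
    rw [← hsum.tsum_eq, ENNReal.ofReal_tsum_of_nonneg
      (fun i => Real.rpow_nonneg (hα_pos i).le c) hsum.summable]
  -- Otherwise a single summand would be at least 1, while the whole sum α ^ c is less than 1.
  have hτ : ∀ i, 0 < τ i := by
    intro i
    by_contra hcon
    push Not at hcon
    have h1 : 1 ≤ (∏ j, β j) ^ (τ i - 1) :=
      Real.one_le_rpow_of_pos_of_le_one_of_nonpos hV hV1.le (by linarith)
    have h2 := le_hasSum hsum i fun j _ => Real.rpow_nonneg (hα_pos j).le c
    have h3 := Real.one_le_rpow h1 hc0.le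
    linarith [Real.rpow_lt_one hα0.le hα1 hc0]
  -- the number of steps between two levels of the tree
  obtain ⟨N, hNdef⟩ : ∃ N, N = ⌊δ * α⁻¹⌋₊ := ⟨_, rfl⟩
  have hαδ : α ≤ δ := by
    have h1 : α ≤ α ^ c := by
      simpa using Real.rpow_le_rpow_of_exponent_ge hα0 hα1.le hc1.le
    nlinarith
  have hN1 : 1 ≤ N := by
    rw [hNdef, Nat.one_le_floor_iff, ← div_eq_mul_inv, one_le_div hα0]
    exact hαδ
  have hN1' : (1 : ℝ) ≤ N := by exact_mod_cast hN1
  have hNα : N * α ≤ δ := by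
    have := Nat.floor_le (show 0 ≤ δ * α⁻¹ by positivity)
    rw [← hNdef, ← div_eq_mul_inv, le_div_iff₀ hα0] at this
    exact this
  have hNlow : δ / (2 * α) ≤ N := by
    have h1 := Nat.lt_floor_add_one (δ * α⁻¹)
    rw [← hNdef] at h1
    have h2 : δ / (2 * α) = δ * α⁻¹ / 2 := by field_simp
    linarith
  have hβN : ∀ j, β j ^ N ≤ 1 / 5 := fun j =>
    (pow_le_of_le_one (hβ0 j).le (hβ1 j).le (by omega)).trans (hβ5 j).le
  have hβN0 : ∀ j, 0 < β j ^ N := fun j => pow_pos (hβ0 j) N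
  have hκeq : kappa β δ α = (∏ j, (1 / 3 : ℝ) * (1 - 5 * β j ^ N)) -
      8 ^ n * (1 + 2 ^ (2 * n + 1)) * δ := by rw [kappa_eq hα0 hδ0, hNdef]
  have hprod1 : ∏ j, (1 / 3 : ℝ) * (1 - 5 * β j ^ N) ≤ 1 :=
    Finset.prod_le_one (fun j _ => by linarith [hβN j]) fun j _ => by linarith [hβN0 j]
  have hprod2 : ∏ j, (1 / 3 : ℝ) * (1 - 5 * β j ^ N) ≤ ∏ j, (1 - β j ^ N) :=
    Finset.prod_le_prod (fun j _ => by linarith [hβN j])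
      fun j _ => by linarith [hβN0 j, hβN j]
  have h8n : (8 : ℝ) ≤ 8 ^ n := le_self_pow₀ (by norm_num) (by omega)
  have h2n : (2 : ℝ) ^ (2 * n + 1) = 2 * 4 ^ n := by rw [pow_succ, pow_mul]; norm_num; ring
  have h4n : (0 : ℝ) < 4 ^ n := by positivity
  -- Positivity of κ bounds the subtracted term, which is at least 8 δ, by a product that is at most
  -- 1.
  have hδ8 : δ ≤ 1 / 8 := by
    rw [hκeq, h2n] at hκ
    have h1 : 8 * δ ≤ 8 ^ n * (1 + 2 * 4 ^ n) * δ := by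
      gcongr
      nlinarith
    linarith
  have hκ1 : kappa β δ α < 1 := by
    have : 0 < 8 ^ n * (1 + 2 ^ (2 * n + 1)) * δ := by positivity
    linarith
  set κ := kappa β δ α with hκdef
  have hκle : κ ≤ (∏ j, (1 - β j ^ N)) - 4 ^ n * (1 + 2 * 4 ^ n) * δ := by
    have : (4 : ℝ) ^ n * (1 + 2 * 4 ^ n) * δ ≤ 8 ^ n * (1 + 2 ^ (2 * n + 1)) * δ := by
      rw [h2n]
      gcongr
      norm_num
    linarith
  have hNδ : (∏ j, β j) ^ (N * (1 - c)) ≤ δ :=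
    rpow_floor_le hV hα0 hα1 hc1 hδ0 hδ8 hαc hNlow
  choose D hD hdiam hcov using fun i =>
    exists_gap_pieces hβ0 hβ1 (hC i) (hG i) (hτ_top i) (hτ_bot i) (hτ i)
  -- the largest ratio
  have : Nonempty (Fin n) := ⟨⟨0, hn⟩⟩
  obtain ⟨j₀, hj₀⟩ := exists_eq_ciSup_of_finite (f := β)
  have hmax : ∀ j, β j ≤ β j₀ := fun j => by
    rw [hj₀]; exact le_ciSup (Set.finite_range β).bddAbove j
  rw [← hj₀]
  set b := β j₀ with hb
  have hb0 : 0 < b := hβ0 j₀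
  have hb1 : b < 1 := hβ1 j₀
  obtain ⟨M, hMdef⟩ : ∃ M, M = ⌈κ * (∏ j, β j) ^ (-(N : ℝ))⌉₊ := ⟨_, rfl⟩
  have hMle : (M : ℝ) ≤ ⌈((∏ j, (1 - β j ^ N)) - 4 ^ n * (1 + 2 * 4 ^ n) * δ) *
      (∏ j, β j) ^ (-(N : ℝ))⌉₊ := by
    rw [hMdef]
    exact Nat.cast_le.2 <| Nat.ceil_le_ceil (mul_le_mul_of_nonneg_right hκle (Real.rpow_nonneg hV.le _))
  have hMge : κ ≤ (∏ j, β j) ^ N * M := by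
    have := Nat.le_ceil (κ * (∏ j, β j) ^ (-(N : ℝ)))
    rw [← hMdef, Real.rpow_neg hV.le, Real.rpow_natCast, ← div_eq_mul_inv,
      div_le_iff₀ (by positivity)] at this
    linarith
  -- Level j has exponent 1 + N j, so the root is A(B[0,1]) + y. W is the volume of the root, and R
  -- and ρ describe the longest side. The root has potential 0 because no scale satisfies 1 ≤ m < 1.
  obtain ⟨hne, hdim⟩ := nonempty_and_le_dimH_of_tree (κ := κ) (ρ := b ^ N) (R := 2 * b)
    (W := 2 ^ n * ∏ j, β j) (M := M) (l := fun j x => 2 * β x ^ (1 + N * j))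
    (P := fun j a => potential β τ D c (1 + N * j) a ≤ ENNReal.ofReal δ)
    (a₀ := fun j => y j - β j)
    (S := (⋂ i, (C i ∪ unboundedGap (C i))) ∩
      ((fun x => Matrix.mulVec (Matrix.diagonal β) x + y) '' Metric.closedBall (0 : Fin n → ℝ) 1))
    hκ hκ1 (by positivity) (pow_lt_one₀ hb0.le hb1 (by omega)) (by positivity) (by positivity)
    (fun j x => by have := hβ0 x; positivity)
    (fun j x => by
      rw [← pow_mul, mul_assoc, ← pow_succ', add_comm]
      have := hmax x
      have := (hβ0 x).le
      gcongr)
    (fun j => by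
      have h1 : ∏ x, 2 * β x ^ (1 + N * j) = 2 ^ n * (∏ x, β x) * ((∏ x, β x) ^ N) ^ j := by
        rw [Finset.prod_mul_distrib, Finset.prod_pow, pow_add, pow_mul]
        simp [mul_assoc]
      rw [h1, mul_assoc _ (((∏ x, β x) ^ N) ^ j), ← mul_pow]
      gcongr)
    (by simp [potential_one])
    (fun j a ha => by
      rw [show 1 + N * (j + 1) = 1 + N * j + N by ring]
      exact exists_small_potential_boxes hβ0 hβ1 hn hD hdiam hc0 hc1 hδ0 hδ1 hα0.le
        (Real.rpow_nonneg hα0.le c) hA hB (1 + N * j) N a hNα hαc hNδ ha hMle)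
    (by
      intro x a ha0 ha hx
      refine ⟨Set.mem_iInter.2 fun i => ?_, ?_⟩
      · by_contra hxi
        obtain ⟨m, hm, k, hk⟩ := hcov i x hxi
        -- At such a level the piece is already charged, yet goodness would force 1 + N j < τ i + m
        -- - 1.
        obtain ⟨j, hj⟩ := exists_nat_gt (max (m : ℝ) (τ i + m))
        have hjm : m < j := by exact_mod_cast (le_max_left _ _).trans_lt hj
        have hjN : j ≤ N * j := Nat.le_mul_of_pos_left j (by omega)
        have h1 := lt_exponent_of_potential_le hV hV1 hc0 hδ1 (ha j) hm (by omega) ⟨x, hx j, hk⟩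
        have h2 := (le_max_right _ _).trans_lt hj
        have h3 : (j : ℝ) ≤ (1 + N * j : ℕ) := by exact_mod_cast (by omega : j ≤ 1 + N * j)
        linarith
      · have h1 : x ∈ cornerBox β 1 fun j => y j - β j := by
          have := hx 0
          rw [ha0] at this
          exact this
        rw [cornerBox_eq_box hβ0] at h1
        simpa [box] using h1)
  refine ⟨hne, le_trans (ENNReal.ofReal_le_ofReal_iff'.2 ?_) hdim⟩
  have hlogb : 0 < |Real.log b| := abs_pos.2 (Real.log_neg hb0 hb1).ne
  -- The factor 2 in `K₁` pays for replacing N = ⌊δ / α⌋ by its lower bound δ / (2 α).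
  have hle : Real.log κ / Real.log (b ^ N) ≤ K₁ β δ α * (α / |Real.log b|) := by
    have h1 : Real.log κ / Real.log (b ^ N) = |Real.log κ| / (N * |Real.log b|) := by
      rw [Real.log_pow, abs_of_neg (Real.log_neg hκ hκ1), abs_of_neg (Real.log_neg hb0 hb1),
        mul_neg, neg_div_neg_eq]
    have h2 : K₁ β δ α * (α / |Real.log b|) = |Real.log κ| / (δ / (2 * α) * |Real.log b|) := by
      rw [K₁, ← hκdef]
      field_simp
    rw [h1, h2]
    gcongr
  rcases le_total 0 ((n : ℝ) - K₁ β δ α * (α / |Real.log b|)) with h | h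
  · left
    rw [max_eq_left h]
    linarith
  · right
    rw [max_eq_right h]
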